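/- Let $\Lambda_N$ be the real Grassmann algebra on $N$ anticommuting generators, $\Lambda_N=\Lambda_N^{(ev)}\oplus\Lambda_N^{(odd)}$ its even and odd parts, $[\cdot]_0:\Lambda_N\to\mathbb{R}$ the projection onto the scalar part (body), and $\Lambda_N^+=\ker[\cdot]_0$. Let $\mathrm{Mat}(m|2n)(\Lambda_N)$ be the algebra of supermatrices $M=\begin{pmatrix}A&B\\C&D\end{pmatrix}$, where $A\in(\Lambda_N^{(ev)})^{m\times m}$, $B\in(\Lambda_N^{(odd)})^{m\times 2n}$, $C\in(\Lambda_N^{(odd)})^{2n\times m}$, $D\in(\Lambda_N^{(ev)})^{2n\times 2n}$, and put $$M^{ST}=\begin{pmatrix}A^T&C^T\\-B^T&D^T\end{pmatrix},\qquad \mathrm{sdet}(M)=\det(A-BD^{-1}C)\,\det(D)^{-1}\ \ (M\text{ invertible}),\qquad e^M=\sum_{j\ge0}\frac{M^j}{j!}.$$ Let $\Omega_{2n}$ be the block-diagonal matrix with $n$ diagonal blocks $\begin{pmatrix}0&1\\-1&0\end{pmatrix}$ and $\mathbf{Q}=\begin{pmatrix}I_m&0\\0&-\frac12\Omega_{2n}\end{pmatrix}$.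 Define the group of superrotations $$\mathrm{SO}_0=\mathrm{SO}_0(m|2n)(\Lambda_N)=\{M\in\mathrm{Mat}(m|2n)(\Lambda_N): M^{ST}\mathbf{Q}M=\mathbf{Q},\ \mathrm{sdet}(M)=1\}$$ (such $M$ are automatically invertible), its Lie algebra $\mathfrak{so}_0=\{X\in\mathrm{Mat}(m|2n)(\Lambda_N): X^{ST}\mathbf{Q}+\mathbf{Q}X=0\}$, and the set $\mathfrak{so}_0(m|2n)(\Lambda_N^+)$ of those elements of $\mathfrak{so}_0$ all of whose entries lie in $\Lambda_N^+$. Let $\mathfrak{so}(k)$ and $\mathrm{Sym}(k)$ be the antisymmetric and the symmetric real $k\times k$ matrices, and $\mathfrak{sp}_\Omega(2n)=\{D\in\mathbb{R}^{2n\times2n}: D^T\Omega_{2n}+\Omega_{2n}D=0\}$; a pair $(A,D)$ of real matrices is identified with the supermatrix $\begin{pmatrix}A&0\\0&D\end{pmatrix}$. **Theorem.** Every $M\in\mathrm{SO}_0$ can be written as $$M=e^Xe^Ye^{\mathbf{Z}},\qquad X\in\mathfrak{so}(m)\times[\mathfrak{sp}_\Omega(2n)\cap\mathfrak{so}(2n)],\quad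 Y\in\{0_m\}\times[\mathfrak{sp}_\Omega(2n)\cap\mathrm{Sym}(2n)],\quad \mathbf{Z}\in\mathfrak{so}_0(m|2n)(\Lambda_N^+).$$ Moreover, the elements $Y$ and $\mathbf{Z}$ in such a decomposition of $M$ are unique. -/

import Mathlib

open Matrix

noncomputable section

namespace SuperRotation

/-- The real Grassmann algebra `Λ_N` on `N` anticommuting generators `f_j = ι (Pi.single j 1)`. -/
abbrev Grassmann (N : ℕ) : Type := ExteriorAlgebra ℝ (Fin N → ℝ)

/-- The canonical topology of the finite-dimensional real vector space `Λ_N`, that is, the topology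
of any norm on it. Matrices over `Λ_N` carry the product topology. -/
instance instTopologicalSpaceGrassmann (N : ℕ) : TopologicalSpace (Grassmann N) :=
  moduleTopology ℝ (Grassmann N)

instance instIsModuleTopologyGrassmann (N : ℕ) : IsModuleTopology ℝ (Grassmann N) := ⟨rfl⟩

instance instFiniteGrassmann (N : ℕ) : Module.Finite ℝ (Grassmann N) :=
  Module.Finite.of_basis (Pi.basisFun ℝ (Fin N)).ExteriorAlgebra

instance instIsTopologicalRingGrassmann (N : ℕ) : IsTopologicalRing (Grassmann N) :=
  IsModuleTopology.isTopologicalRing ℝ (Grassmann N)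

instance instT2SpaceGrassmann (N : ℕ) : T2Space (Grassmann N) := by
  let b := (Pi.basisFun ℝ (Fin N)).ExteriorAlgebra
  exact T2Space.of_injective_continuous (f := b.equivFun) b.equivFun.injective
    (IsModuleTopology.continuous_of_linearMap b.equivFun.toLinearMap)

/-- The body homomorphism `[·]₀ : Λ_N → ℝ`, which kills all generators. -/
def body (N : ℕ) : Grassmann N →ₐ[ℝ] ℝ := ExteriorAlgebra.algebraMapInv

/-- The even part `Λ_N^(ev)`, the span of the products of an even number of generators. -/
abbrev evenPart (N : ℕ) : Subalgebra ℝ (Grassmann N) :=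
  CliffordAlgebra.even (0 : QuadraticForm ℝ (Fin N → ℝ))

/-- The odd part `Λ_N^(odd)`, the span of the products of an odd number of generators. -/
abbrev oddPart (N : ℕ) : Submodule ℝ (Grassmann N) :=
  CliffordAlgebra.evenOdd (0 : QuadraticForm ℝ (Fin N → ℝ)) 1

theorem odd_mul_odd {N : ℕ} {a b : Grassmann N} (ha : a ∈ oddPart N) (hb : b ∈ oddPart N) :
    a * b ∈ evenPart N := by
  have h := SetLike.mul_mem_graded
    (A := CliffordAlgebra.evenOdd (0 : QuadraticForm ℝ (Fin N → ℝ))) ha hb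
  rw [show (1 : ZMod 2) + 1 = 0 from rfl] at h
  exact h

theorem even_mul_odd {N : ℕ} {a b : Grassmann N} (ha : a ∈ evenPart N) (hb : b ∈ oddPart N) :
    a * b ∈ oddPart N := by
  have h := SetLike.mul_mem_graded
    (A := CliffordAlgebra.evenOdd (0 : QuadraticForm ℝ (Fin N → ℝ))) (i := 0) (j := 1) ha hb
  rwa [zero_add] at h

theorem odd_mul_even {N : ℕ} {a b : Grassmann N} (ha : a ∈ oddPart N) (hb : b ∈ evenPart N) :
    a * b ∈ oddPart N := by
  have h := SetLike.mul_mem_graded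
    (A := CliffordAlgebra.evenOdd (0 : QuadraticForm ℝ (Fin N → ℝ))) (i := 1) (j := 0) ha hb
  rwa [add_zero] at h

theorem even_commute {N : ℕ} {a : Grassmann N} (ha : a ∈ evenPart N) (b : Grassmann N) :
    a * b = b * a := by
  have anti : ∀ v w : Fin N → ℝ, ExteriorAlgebra.ι ℝ v * ExteriorAlgebra.ι ℝ w =
      -(ExteriorAlgebra.ι ℝ w * ExteriorAlgebra.ι ℝ v) := fun v w =>
    eq_neg_of_add_eq_zero_left (ExteriorAlgebra.ι_add_mul_swap v w)
  have hι : ∀ v w : Fin N → ℝ, ∀ c : Grassmann N,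
      (ExteriorAlgebra.ι ℝ v * ExteriorAlgebra.ι ℝ w) * c =
        c * (ExteriorAlgebra.ι ℝ v * ExteriorAlgebra.ι ℝ w) := by
    intro v w c
    induction c using ExteriorAlgebra.induction with
    | algebraMap r => exact (Algebra.commutes r _).symm
    | ι x =>
      calc ExteriorAlgebra.ι ℝ v * ExteriorAlgebra.ι ℝ w * ExteriorAlgebra.ι ℝ x
          = ExteriorAlgebra.ι ℝ v * (ExteriorAlgebra.ι ℝ w * ExteriorAlgebra.ι ℝ x) :=
            mul_assoc _ _ _
        _ = -(ExteriorAlgebra.ι ℝ v * ExteriorAlgebra.ι ℝ x) * ExteriorAlgebra.ι ℝ w := by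
            rw [anti w x, mul_neg, neg_mul, mul_assoc]
        _ = ExteriorAlgebra.ι ℝ x * (ExteriorAlgebra.ι ℝ v * ExteriorAlgebra.ι ℝ w) := by
            rw [anti v x, neg_neg, mul_assoc]
    | mul a b ha hb => rw [← mul_assoc, ha, mul_assoc, hb, mul_assoc]
    | add a b ha hb => rw [mul_add, add_mul, ha, hb]
  induction a, ha using CliffordAlgebra.even_induction with
  | algebraMap r => exact Algebra.commutes r b
  | add x y _ _ hx hy => exact (add_mul x y b).trans ((congrArg₂ _ hx hy).trans (mul_add b x y).symm)
  | ι_mul_ι_mul v w x _ hx =>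
    exact (mul_assoc _ x b).trans <| (congrArg _ hx).trans <| (mul_assoc _ b x).symm.trans <|
      (congrArg (· * x) (hι v w b)).trans (mul_assoc b _ x)

/-- The even part of the Grassmann algebra is a commutative ring. -/
instance instCommRingEvenPart (N : ℕ) : CommRing (evenPart N) :=
  { (inferInstance : Ring (evenPart N)) with
    mul_comm := fun a b => Subtype.ext (even_commute a.2 b.1) }

/-- The algebra `Mat(p|q)(Λ_N)` of supermatrices `(A B; C D)`, with the rows and columns of the two
blocks indexed by `ι` and `κ`: the entries of `A` and `D` are even, those of `B` and `C` are odd. -/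
def superMat (N : ℕ) (ι κ : Type) [Fintype ι] [Fintype κ] [DecidableEq ι] [DecidableEq κ] :
    Subalgebra ℝ (Matrix (ι ⊕ κ) (ι ⊕ κ) (Grassmann N)) where
  carrier := {M | (∀ i j, M (Sum.inl i) (Sum.inl j) ∈ evenPart N) ∧
    (∀ i j, M (Sum.inl i) (Sum.inr j) ∈ oddPart N) ∧
    (∀ i j, M (Sum.inr i) (Sum.inl j) ∈ oddPart N) ∧
    (∀ i j, M (Sum.inr i) (Sum.inr j) ∈ evenPart N)}
  mul_mem' := by
    rintro M L ⟨hA, hB, hC, hD⟩ ⟨hA', hB', hC', hD'⟩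
    refine ⟨fun i j => ?_, fun i j => ?_, fun i j => ?_, fun i j => ?_⟩ <;>
      rw [Matrix.mul_apply, Fintype.sum_sum_type]
    · exact add_mem (sum_mem fun k _ => mul_mem (hA i k) (hA' k j))
        (sum_mem fun k _ => odd_mul_odd (hB i k) (hC' k j))
    · exact add_mem (sum_mem fun k _ => even_mul_odd (hA i k) (hB' k j))
        (sum_mem fun k _ => odd_mul_even (hB i k) (hD' k j))
    · exact add_mem (sum_mem fun k _ => odd_mul_even (hC i k) (hA' k j))
        (sum_mem fun k _ => even_mul_odd (hD i k) (hC' k j))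
    · exact add_mem (sum_mem fun k _ => odd_mul_odd (hC i k) (hB' k j))
        (sum_mem fun k _ => mul_mem (hD i k) (hD' k j))
  add_mem' := by
    rintro M L ⟨hA, hB, hC, hD⟩ ⟨hA', hB', hC', hD'⟩
    exact ⟨fun i j => add_mem (hA i j) (hA' i j), fun i j => add_mem (hB i j) (hB' i j),
      fun i j => add_mem (hC i j) (hC' i j), fun i j => add_mem (hD i j) (hD' i j)⟩
  algebraMap_mem' := by
    intro r
    refine ⟨fun i j => ?_, fun i j => ?_, fun i j => ?_, fun i j => ?_⟩ <;>
      rw [Matrix.algebraMap_matrix_apply]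
    · split_ifs
      · exact (evenPart N).algebraMap_mem r
      · exact zero_mem _
    · simp
    · simp
    · split_ifs
      · exact (evenPart N).algebraMap_mem r
      · exact zero_mem _

section Blocks

variable {N : ℕ} {ι κ : Type} [Fintype ι] [Fintype κ] [DecidableEq ι] [DecidableEq κ]

/-- The even block `A` of a supermatrix, over the commutative ring `Λ_N^(ev)`. -/
def blockA (M : superMat N ι κ) : Matrix ι ι (evenPart N) :=
  Matrix.of fun i j => ⟨M.1 (Sum.inl i) (Sum.inl j), M.2.1 i j⟩

/-- The even block `D` of a supermatrix, over the commutative ring `Λ_N^(ev)`. -/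
def blockD (M : superMat N ι κ) : Matrix κ κ (evenPart N) :=
  Matrix.of fun i j => ⟨M.1 (Sum.inr i) (Sum.inr j), M.2.2.2.2 i j⟩

theorem odd_even_odd_mem (M : superMat N ι κ) (E : Matrix κ κ (evenPart N)) (i j : ι) :
    (M.1.toBlocks₁₂ * E.map (fun x => (x : Grassmann N)) * M.1.toBlocks₂₁) i j ∈ evenPart N := by
  rw [Matrix.mul_apply]
  refine sum_mem fun k _ => odd_mul_odd ?_ (M.2.2.2.1 k j)
  rw [Matrix.mul_apply]
  exact sum_mem fun l _ => odd_mul_even (M.2.2.1 i l) (E l k).2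

/-- The matrix `B D⁻¹ C`, over the commutative ring `Λ_N^(ev)`. -/
def blockBinvDC (M : superMat N ι κ) : Matrix ι ι (evenPart N) :=
  Matrix.of fun i j =>
    ⟨(M.1.toBlocks₁₂ * ((blockD M)⁻¹).map (fun x => (x : Grassmann N)) * M.1.toBlocks₂₁) i j,
      odd_even_odd_mem M _ i j⟩

/-- The superdeterminant (Berezinian) `det (A - B D⁻¹ C) * (det D)⁻¹` of an invertible
supermatrix. -/
def sdet (M : superMat N ι κ) : evenPart N :=
  (blockA M - blockBinvDC M).det * Ring.inverse (blockD M).det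

/-- The supertranspose `(Aᵀ Cᵀ; -Bᵀ Dᵀ)` of `(A B; C D)`. -/
def supertranspose (M : Matrix (ι ⊕ κ) (ι ⊕ κ) (Grassmann N)) :
    Matrix (ι ⊕ κ) (ι ⊕ κ) (Grassmann N) :=
  Matrix.fromBlocks M.toBlocks₁₁ᵀ M.toBlocks₂₁ᵀ (-M.toBlocks₁₂ᵀ) M.toBlocks₂₂ᵀ

/-- The block-diagonal supermatrix with real blocks `A` and `D`. -/
def realBlocks (N : ℕ) (A : Matrix ι ι ℝ) (D : Matrix κ κ ℝ) :
    Matrix (ι ⊕ κ) (ι ⊕ κ) (Grassmann N) :=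
  Matrix.fromBlocks (A.map (algebraMap ℝ (Grassmann N))) 0 0 (D.map (algebraMap ℝ (Grassmann N)))

end Blocks

/-- The index set of the `2n` fermionic coordinates; `(0, j)` and `(1, j)` stand for the two
consecutive coordinates of the `j`-th symplectic plane. -/
abbrev Ferm (n : ℕ) : Type := Fin 2 × Fin n

/-- The matrix `Ω_{2n}`, block diagonal with `n` blocks `(0 1; -1 0)`. -/
def Omega (n : ℕ) : Matrix (Ferm n) (Ferm n) ℝ :=
  Matrix.blockDiagonal fun _ : Fin n => !![0, 1; -1, 0]

/-- The matrix `Q = (I_m 0; 0 -Ω_{2n}/2)` of the inner product of supervectors. -/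
def Q (N m n : ℕ) : Matrix (Fin m ⊕ Ferm n) (Fin m ⊕ Ferm n) (Grassmann N) :=
  realBlocks N 1 (-(1 / 2 : ℝ) • Omega n)

/-- The group `O₀(m|2n)(Λ_N)`. -/
def O0 (N m n : ℕ) : Set (superMat N (Fin m) (Ferm n)) :=
  {M | supertranspose M.1 * Q N m n * M.1 - Q N m n = 0}

/-- The group `SO₀(m|2n)(Λ_N)` of superrotations. -/
def SO0 (N m n : ℕ) : Set (superMat N (Fin m) (Ferm n)) :=
  {M | M ∈ O0 N m n ∧ sdet M = 1}

/-- The Lie algebra `𝔰𝔬₀(m|2n)(Λ_N)` of super anti-symmetric supermatrices. -/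
def so0 (N m n : ℕ) : Set (superMat N (Fin m) (Ferm n)) :=
  {X | supertranspose X.1 * Q N m n + Q N m n * X.1 = 0}

/-- The set `𝔰𝔬₀(m|2n)(Λ_N⁺)` of the elements of `𝔰𝔬₀` all of whose entries have body zero. -/
def so0Nilpotent (N m n : ℕ) : Set (superMat N (Fin m) (Ferm n)) :=
  {Z | Z ∈ so0 N m n ∧ ∀ i j, body N (Z.1 i j) = 0}

/-- The symplectic Lie algebra `𝔰𝔭_Ω(2n)`. -/
def spOmega (n : ℕ) : Set (Matrix (Ferm n) (Ferm n) ℝ) :=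
  {D | Dᵀ * Omega n + Omega n * D = 0}

/-- The supermatrices in `𝔰𝔬(m) × [𝔰𝔭_Ω(2n) ∩ 𝔰𝔬(2n)]`. -/
def compactPart (N m n : ℕ) : Set (superMat N (Fin m) (Ferm n)) :=
  {X | ∃ A ∈ LieAlgebra.Orthogonal.so (Fin m) ℝ,
    ∃ D ∈ spOmega n ∩ {D | D ∈ LieAlgebra.Orthogonal.so (Ferm n) ℝ}, X.1 = realBlocks N A D}

/-- The supermatrices in `{0_m} × [𝔰𝔭_Ω(2n) ∩ Sym(2n)]`. -/
def symmetricPart (N m n : ℕ) : Set (superMat N (Fin m) (Ferm n)) :=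
  {Y | ∃ D ∈ spOmega n ∩ {D | D.IsSymm}, Y.1 = realBlocks N 0 D}

end SuperRotation

end

open Matrix

noncomputable section

namespace SuperRotation

/-! ### Polynomial functional calculus and matrix exponentials on eigenvectors -/

section RealMatrix

open Polynomial

variable {ι : Type*} [Fintype ι] [DecidableEq ι]

/-! The body map splits the problem into a real one and a nilpotent one. Odd elements have body
zero, so the body of a superrotation is block diagonal, with blocks `A₀` orthogonal and `D₀`
symplectic. Polar decomposition gives `D₀ = exp D * exp E` (`exists_exp_mul_exp_of_symplectic`),
where the orthogonal factor commutes with `Ω`, hence is unitary and has a logarithm. In particular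
`det D₀ > 0`. The body of `sdet M = 1` reads `det A₀ = det D₀`, so `A₀` is a rotation and has a skew
logarithm (`exists_skew_exp_eq`).

Dividing `M` by its body on the left leaves `1 + u` with `u` of body zero, hence nilpotent
(`isNilpotent_of_body_eq_zero`). Its logarithm is a polynomial in `u`, so it is again a supermatrix,
and injectivity of `exp` on nilpotents (`eq_of_nilpotent_exp_eq`) turns invariance of `Q` into the
Lie algebra equation (`exists_so0Nilpotent_exp_eq`).

For uniqueness, the body removes `Z`, and `D₀ᵀ * D₀ = exp (2 E)` determines the symmetric matrix
`E`. Equal bodies then cancel, and injectivity of `exp` on nilpotents gives `Z`.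

Real logarithms are built as polynomials in a symmetric matrix, found by interpolation on its
spectrum; whatever commutes with the matrix then commutes with them. -/

theorem aeval_mulVec_eigen {S : Matrix ι ι ℝ} {c : ℝ} {v : ι → ℝ} (h : S *ᵥ v = c • v)
    (p : ℝ[X]) : aeval S p *ᵥ v = p.eval c • v := by
  induction p using Polynomial.induction_on with
  | C a => simp [Algebra.algebraMap_eq_smul_one, smul_mulVec]
  | add p q hp hq => simp [add_mulVec, hp, hq, add_smul]
  | monomial n a ih =>
    rw [pow_succ, ← mul_assoc, map_mul, aeval_X, ← mulVec_mulVec, h, mulVec_smul, ih, smul_smul]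
    simp only [eval_mul, eval_X, mul_comm]

/-- A polynomial in `S` acts on the eigenspaces of `S` as any prescribed function. -/
theorem exists_aeval_mulVec_eq (S : Matrix ι ι ℝ) (f : ℝ → ℝ) :
    ∃ p : ℝ[X], ∀ (c : ℝ) (v : ι → ℝ), S *ᵥ v = c • v → aeval S p *ᵥ v = f c • v := by
  classical
  -- The nodes are the roots of the characteristic polynomial, so every eigenvalue is a node.
  refine ⟨Lagrange.interpolate (Matrix.toLin' S).charpoly.roots.toFinset id f, fun c v h => ?_⟩
  rw [aeval_mulVec_eigen h]
  by_cases hv : v = 0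
  · simp [hv]
  congr 1
  refine Lagrange.eval_interpolate_at_node (v := id) f Function.injective_id.injOn ?_
  rw [Multiset.mem_toFinset, mem_roots (LinearMap.charpoly_monic _).ne_zero,
    ← Module.End.hasEigenvalue_iff_isRoot_charpoly]
  exact Module.End.hasEigenvalue_of_hasEigenvector (x := v)
    (Module.End.hasEigenvector_iff.2 ⟨Module.End.mem_eigenspace_iff.2 (by simpa using h), hv⟩)

/-- The spectral theorem provides a basis of eigenvectors of `S`. Matrix identities below are
checked this way, one eigenvector at a time. -/
theorem ext_of_eigen {S : Matrix ι ι ℝ} (hS : Sᵀ = S) {A B : Matrix ι ι ℝ}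
    (h : ∀ (c : ℝ) (v : ι → ℝ), S *ᵥ v = c • v → A *ᵥ v = B *ᵥ v) : A = B := by
  have hH : S.IsHermitian := by rwa [IsHermitian, conjTranspose_eq_transpose_of_trivial]
  apply Matrix.toEuclideanLin.injective
  refine hH.eigenvectorBasis.toBasis.ext fun i => ?_
  have := h _ _ (hH.mulVec_eigenvectorBasis i)
  simpa [Matrix.toLpLin_apply] using this

theorem transpose_aeval {S : Matrix ι ι ℝ} (hS : Sᵀ = S) (p : ℝ[X]) :
    (aeval S p)ᵀ = aeval S p := by
  induction p using Polynomial.induction_on' with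
  | add p q hp hq => rw [map_add, transpose_add, hp, hq]
  | monomial n a =>
    simp [aeval_monomial, Algebra.algebraMap_eq_smul_one, transpose_pow, hS]

theorem commute_aeval {A B : Matrix ι ι ℝ} (h : Commute A B) (p : ℝ[X]) :
    Commute A (aeval B p) := by
  induction p using Polynomial.induction_on' with
  | add p q hp hq => rw [map_add]; exact hp.add_right hq
  | monomial n a =>
    rw [aeval_monomial]
    exact (Algebra.commute_algebraMap_right a A).mul_right (h.pow_right n)

section Exp

attribute [local instance] Matrix.linftyOpNormedRing Matrix.linftyOpNormedAlgebra

theorem hasSum_exp_real (A : Matrix ι ι ℝ) :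
    HasSum (fun k : ℕ => ((k.factorial : ℝ)⁻¹) • A ^ k) (NormedSpace.exp A) :=
  NormedSpace.exp_series_hasSum_exp' (𝕂 := ℝ) A

end Exp

theorem hasSum_exp_mulVec (A : Matrix ι ι ℝ) (v : ι → ℝ) :
    HasSum (fun k : ℕ => ((k.factorial : ℝ)⁻¹) • (A ^ k *ᵥ v)) (NormedSpace.exp A *ᵥ v) := by
  have h := (hasSum_exp_real A).map ((Matrix.mulVecBilin ℝ ℝ).flip v).toAddMonoidHom
    (by
      change Continuous fun B : Matrix ι ι ℝ => B *ᵥ v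
      fun_prop)
  refine h.congr_fun fun k => ?_
  simp

theorem exp_mulVec_eigen {A : Matrix ι ι ℝ} {a : ℝ} {v : ι → ℝ} (h : A *ᵥ v = a • v) :
    NormedSpace.exp A *ᵥ v = Real.exp a • v := by
  have hk : ∀ k : ℕ, A ^ k *ᵥ v = a ^ k • v := fun k => by
    have := aeval_mulVec_eigen h (X ^ k)
    simpa using this
  have h1 := hasSum_exp_mulVec A v
  simp only [hk] at h1
  have h2 := (NormedSpace.exp_series_hasSum_exp' (𝕂 := ℝ) a).smul_const v
  rw [← Real.exp_eq_exp_ℝ] at h2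
  simp only [smul_assoc] at h2
  exact h1.unique h2

/-- On the span of `v` and `A v`, `A / t` squares to `-1`; even and odd powers of the series sum to
cosine and sine. -/
theorem exp_mulVec_rotation {A : Matrix ι ι ℝ} {t : ℝ} (ht : t ≠ 0) {v : ι → ℝ}
    (h : A *ᵥ (A *ᵥ v) = -(t ^ 2) • v) :
    NormedSpace.exp A *ᵥ v = Real.cos t • v + (Real.sin t / t) • (A *ᵥ v) := by
  have he : ∀ k : ℕ, A ^ (2 * k) *ᵥ v = ((-1) ^ k * t ^ (2 * k)) • v := by
    intro k
    induction k with
    | zero => simp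
    | succ k ih =>
      rw [mul_add, mul_one, pow_add, pow_two A, ← mulVec_mulVec, ← mulVec_mulVec, h, mulVec_smul,
        ih, smul_smul]
      congr 1; ring
  have ho : ∀ k : ℕ, A ^ (2 * k + 1) *ᵥ v = ((-1) ^ k * t ^ (2 * k)) • (A *ᵥ v) := by
    intro k
    rw [pow_succ', ← mulVec_mulVec, he, mulVec_smul]
  refine (hasSum_exp_mulVec A v).unique (HasSum.even_add_odd ?_ ?_)
  · refine ((Real.hasSum_cos t).smul_const v).congr_fun fun k => ?_
    rw [he, smul_smul]; congr 1; ring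
  · refine (((Real.hasSum_sin t).div_const t).smul_const (A *ᵥ v)).congr_fun fun k => ?_
    rw [ho, smul_smul]; congr 1; field_simp; ring

end RealMatrix

/-! ### Real logarithms and the polar decomposition of the symplectic group -/

section RealLog

open Polynomial

variable {ι : Type*} [Fintype ι] [DecidableEq ι]

/-- An exponential is the square of an invertible matrix. -/
theorem det_exp_pos (A : Matrix ι ι ℝ) : 0 < (NormedSpace.exp A).det := by
  have h : NormedSpace.exp A = NormedSpace.exp ((1 / 2 : ℝ) • A) * NormedSpace.exp ((1 / 2 : ℝ) • A) := by
    rw [← Matrix.exp_add_of_commute _ _ (Commute.refl _), ← add_smul]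
    norm_num
  rw [h, det_mul]
  have := (isUnit_iff_isUnit_det _).1 (Matrix.isUnit_exp ((1 / 2 : ℝ) • A))
  exact mul_self_pos.2 this.ne_zero

/-- A symmetric logarithm of a real matrix is unique. -/
theorem eq_of_exp_eq_of_symm {A B : Matrix ι ι ℝ} (hA : Aᵀ = A) (hB : Bᵀ = B)
    (h : NormedSpace.exp A = NormedSpace.exp B) : A = B := by
  -- Both `A` and `B` turn out to be the same polynomial in their common exponential.
  obtain ⟨p, hp⟩ := exists_aeval_mulVec_eq (NormedSpace.exp A) Real.log
  have key : ∀ C : Matrix ι ι ℝ, Cᵀ = C → NormedSpace.exp C = NormedSpace.exp A →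
      aeval (NormedSpace.exp A) p = C := fun C hC hCA => by
    refine ext_of_eigen hC fun c v hv => ?_
    rw [hp (Real.exp c) v (by rw [← hCA, exp_mulVec_eigen hv]), Real.log_exp, hv]
  exact (key A hA rfl).symm.trans (key B hB h.symm)

/-- Polar decomposition in exponential form: for invertible `D`, half the logarithm of `Dᵀ D`. -/
theorem exists_symm_exp_mul_self {D : Matrix ι ι ℝ} (hD : IsUnit D) :
    ∃ Y : Matrix ι ι ℝ, Yᵀ = Y ∧ NormedSpace.exp Y * NormedSpace.exp Y = Dᵀ * D ∧
      ∀ J : Matrix ι ι ℝ, Dᵀ * D * J * (Dᵀ * D) = J → Y * J = -(J * Y) := by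
  set R := Dᵀ * D with hR
  have hRs : Rᵀ = R := by rw [hR, transpose_mul, transpose_transpose]
  obtain ⟨p, hp⟩ := exists_aeval_mulVec_eq R fun c => 1 / 2 * Real.log c
  have hpos : ∀ (c : ℝ) (v : ι → ℝ), R *ᵥ v = c • v → v ≠ 0 → 0 < c := by
    intro c v hv hv0
    have h1 : (D *ᵥ v) ⬝ᵥ (D *ᵥ v) = c * (v ⬝ᵥ v) := by
      rw [← smul_eq_mul, ← dotProduct_smul, ← hv, hR, ← mulVec_mulVec, dotProduct_mulVec v,
        vecMul_transpose]
    have h2 : 0 < v ⬝ᵥ v := by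
      have := dotProduct_star_self_pos_iff.2 hv0
      simpa using this
    have h3 : 0 < (D *ᵥ v) ⬝ᵥ (D *ᵥ v) := by
      have h4 : D *ᵥ v ≠ 0 := fun h => hv0 (mulVec_injective_of_isUnit hD (by simpa using h))
      have := dotProduct_star_self_pos_iff.2 h4
      simpa using this
    rw [h1] at h3
    exact (pos_iff_pos_of_mul_pos h3).2 h2
  refine ⟨aeval R p, transpose_aeval hRs p, ext_of_eigen hRs fun c v hv => ?_, fun J hJ =>
    ext_of_eigen hRs fun c v hv => ?_⟩
  · by_cases hv0 : v = 0
    · simp [hv0]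
    rw [← mulVec_mulVec, exp_mulVec_eigen (hp c v hv), mulVec_smul, exp_mulVec_eigen (hp c v hv),
      smul_smul, ← Real.exp_add, hv]
    congr 1
    rw [← add_mul]
    norm_num
    exact Real.exp_log (hpos c v hv hv0)
  · by_cases hv0 : v = 0
    · simp [hv0]
    have hc := hpos c v hv hv0
    -- `J` sends the eigenvalue `c` of `R` to `c⁻¹`, and the logarithm changes sign.
    have h1 : R *ᵥ (J *ᵥ v) = c⁻¹ • (J *ᵥ v) := by
      have : c • (R *ᵥ (J *ᵥ v)) = J *ᵥ v := by
        rw [← mulVec_smul, ← mulVec_smul, ← hv, mulVec_mulVec, mulVec_mulVec, hJ]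
      rw [← this, smul_smul, inv_mul_cancel₀ hc.ne', one_smul, this]
    rw [← mulVec_mulVec, hp _ _ h1, neg_mulVec, ← mulVec_mulVec, hp _ _ hv, mulVec_smul,
      Real.log_inv, ← neg_smul]
    congr 1; ring

/-- Every orthogonal matrix is the exponential of a skew matrix up to a reflection `1 - 2 P`. -/
theorem exists_exp_mul_reflection {O : Matrix ι ι ℝ} (hO : Oᵀ * O = 1) :
    ∃ X P : Matrix ι ι ℝ, Xᵀ = -X ∧ Pᵀ = P ∧ P * P = P ∧ X * P = 0 ∧ P * X = 0 ∧
      O = NormedSpace.exp X * (1 - (2 : ℝ) • P) ∧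
      ∀ W : Matrix ι ι ℝ, Commute W O → Commute W Oᵀ → Commute W X ∧ Commute W P := by
  have hO' : O * Oᵀ = 1 := mul_eq_one_comm.1 hO
  -- `S` and `K` play the roles of cosine and sine of the angle: they commute and `K * K = S * S -
  -- 1`.
  set S := (1 / 2 : ℝ) • (O + Oᵀ) with hS
  set K := (1 / 2 : ℝ) • (O - Oᵀ) with hK
  have hSs : Sᵀ = S := by simp [hS, add_comm]
  have hKs : Kᵀ = -K := by simp [hK, ← smul_neg]
  have hSK : S + K = O := by rw [hS, hK]; module
  have hcomm : Commute K S := by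
    simp only [Commute, SemiconjBy, hS, hK, smul_mul_smul_comm, mul_add, add_mul, mul_sub, sub_mul,
      hO, hO']
    congr 1; abel
  have hKK : K * K = S * S - 1 := by
    simp only [hS, hK, smul_mul_smul_comm, mul_add, add_mul, mul_sub, sub_mul, hO, hO']
    module
  -- `X` will be `p(S) * K`: angle over sine where the rotation is proper, and zero where `c = ±1`,
  -- since `K` vanishes there. `q(S)` is the projection onto the `-1` eigenspace, which `X` leaves
  -- uncorrected.
  obtain ⟨p, hp⟩ := exists_aeval_mulVec_eq S
    fun c => if c ^ 2 < 1 then Real.arccos c / √(1 - c ^ 2) else 0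
  obtain ⟨q, hq⟩ := exists_aeval_mulVec_eq S fun c => if c = -1 then 1 else 0
  have hSKv : ∀ (c : ℝ) (v : ι → ℝ), S *ᵥ v = c • v → S *ᵥ (K *ᵥ v) = c • (K *ᵥ v) := by
    intro c v hv
    rw [mulVec_mulVec, ← hcomm.eq, ← mulVec_mulVec, hv, mulVec_smul]
  have hKKv : ∀ (c : ℝ) (v : ι → ℝ), S *ᵥ v = c • v → K *ᵥ (K *ᵥ v) = (c ^ 2 - 1) • v := by
    intro c v hv
    rw [mulVec_mulVec, hKK, sub_mulVec, ← mulVec_mulVec, hv, mulVec_smul, hv, one_mulVec]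
    module
  have hKnorm : ∀ (c : ℝ) (v : ι → ℝ), S *ᵥ v = c • v →
      (K *ᵥ v) ⬝ᵥ (K *ᵥ v) = (1 - c ^ 2) * (v ⬝ᵥ v) := by
    intro c v hv
    rw [dotProduct_mulVec, ← mulVec_transpose, hKs, neg_mulVec, hKKv c v hv, ← neg_smul,
      smul_dotProduct, smul_eq_mul]
    ring
  have hKzero : ∀ (c : ℝ) (v : ι → ℝ), S *ᵥ v = c • v → ¬ c ^ 2 < 1 → K *ᵥ v = 0 := by
    intro c v hv hc
    have h1 : 0 ≤ v ⬝ᵥ v := by simpa using dotProduct_star_self_nonneg v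
    have h2 : 0 ≤ (K *ᵥ v) ⬝ᵥ (K *ᵥ v) := by simpa using dotProduct_star_self_nonneg (K *ᵥ v)
    have h3 := hKnorm c v hv
    have h4 : (K *ᵥ v) ⬝ᵥ (K *ᵥ v) = 0 := by nlinarith
    exact dotProduct_self_eq_zero.1 h4
  have hcase : ∀ (c : ℝ) (v : ι → ℝ), S *ᵥ v = c • v → v ≠ 0 → ¬ c ^ 2 < 1 → c = 1 ∨ c = -1 := by
    intro c v hv hv0 hc
    have h3 := hKnorm c v hv
    rw [hKzero c v hv hc, zero_dotProduct] at h3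
    have : v ⬝ᵥ v ≠ 0 := fun h => hv0 (dotProduct_self_eq_zero.1 h)
    have h4 : 1 - c ^ 2 = 0 := by
      rcases mul_eq_zero.1 h3.symm with h | h
      · exact h
      · exact absurd h this
    have h5 : c ^ 2 = 1 := by linarith
    simpa using h5
  have hXT : (aeval S p * K)ᵀ = -(aeval S p * K) := by
    rw [transpose_mul, transpose_aeval hSs, hKs, neg_mul, (commute_aeval hcomm p).eq]
  have hXP : aeval S p * K * aeval S q = 0 := by
    refine ext_of_eigen hSs fun c v hv => ?_
    rw [← mulVec_mulVec, hq c v hv, mulVec_smul, zero_mulVec]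
    split_ifs with h
    · rw [← mulVec_mulVec, hKzero c v hv (by rw [h]; norm_num), mulVec_zero, smul_zero]
    · rw [zero_smul]
  refine ⟨aeval S p * K, aeval S q, hXT, transpose_aeval hSs q, ?_, hXP, ?_, ?_, ?_⟩
  · refine ext_of_eigen hSs fun c v hv => ?_
    rw [← mulVec_mulVec, hq c v hv, mulVec_smul, hq c v hv]
    split_ifs <;> simp
  · have := congrArg transpose hXP
    rwa [transpose_mul, hXT, transpose_aeval hSs, mul_neg, transpose_zero, neg_eq_zero] at this
  · refine ext_of_eigen hSs fun c v hv => ?_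
    by_cases hv0 : v = 0
    · simp [hv0]
    rw [← mulVec_mulVec, sub_mulVec, one_mulVec, smul_mulVec, hq c v hv, ← hSK, add_mulVec, hv]
    by_cases hc : c ^ 2 < 1
    · have hc1 : -1 < c ∧ c < 1 := abs_lt.1 ((sq_lt_one_iff_abs_lt_one c).1 hc)
      have ht : Real.arccos c ≠ 0 := (Real.arccos_pos.2 hc1.2).ne'
      have hs : 0 < √(1 - c ^ 2) := Real.sqrt_pos.2 (by linarith)
      have hs2 : √(1 - c ^ 2) ^ 2 = 1 - c ^ 2 := Real.sq_sqrt (by linarith)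
      have hXv : ∀ w : ι → ℝ, S *ᵥ w = c • w →
          (aeval S p * K) *ᵥ w = (Real.arccos c / √(1 - c ^ 2)) • (K *ᵥ w) := by
        intro w hw
        rw [← mulVec_mulVec, hp _ _ (hSKv c w hw), if_pos hc]
      have hXX : (aeval S p * K) *ᵥ ((aeval S p * K) *ᵥ v) = -(Real.arccos c ^ 2) • v := by
        rw [hXv v hv, mulVec_smul, hXv _ (hSKv c v hv), hKKv c v hv, smul_smul, smul_smul]
        congr 1
        field_simp
        rw [hs2]; ring
      rw [if_neg (by linarith [hc1.1]), zero_smul, smul_zero, sub_zero, exp_mulVec_rotation ht hXX,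
        Real.cos_arccos hc1.1.le hc1.2.le, Real.sin_arccos, hXv v hv, smul_smul]
      congr 1
      rw [div_mul_div_cancel₀ ht, div_self hs.ne', one_smul]
    · have hX0 : (aeval S p * K) *ᵥ v = (0 : ℝ) • v := by
        rw [← mulVec_mulVec, hKzero c v hv hc, mulVec_zero, zero_smul]
      rw [hKzero c v hv hc, mulVec_sub, mulVec_smul, mulVec_smul, exp_mulVec_eigen hX0,
        Real.exp_zero, one_smul]
      rcases hcase c v hv hv0 hc with rfl | rfl
      · norm_num
      · rw [if_pos rfl]; module
  · intro W h1 h2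
    have h3 : Commute W S := (h1.add_right h2).smul_right _
    have h4 : Commute W K := (h1.sub_right h2).smul_right _
    exact ⟨(commute_aeval h3 p).mul_right h4, commute_aeval h3 q⟩

/-- `J` is a complex structure on the range of `P` and zero on its kernel, so this is a half turn of
the range. -/
theorem exp_pi_smul_of_sq {J P : Matrix ι ι ℝ} (hJ : J * J = -P) (hJP : J * P = J)
    (hP : P * P = P) : NormedSpace.exp (Real.pi • J) = 1 - (2 : ℝ) • P := by
  refine toLin'.injective (LinearMap.ext fun v => ?_)
  simp only [toLin'_apply]
  have h1 : NormedSpace.exp (Real.pi • J) *ᵥ (P *ᵥ v) = -(P *ᵥ v) := by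
    rw [exp_mulVec_rotation Real.pi_ne_zero, Real.cos_pi, Real.sin_pi]
    · simp
    · rw [mulVec_mulVec, mulVec_mulVec, smul_mul_smul_comm, hJ, smul_mul_assoc, neg_mul, hP,
        smul_neg, neg_mulVec, smul_mulVec, neg_smul, pow_two]
  have h2 : NormedSpace.exp (Real.pi • J) *ᵥ (v - P *ᵥ v) = v - P *ᵥ v := by
    have h0 : (Real.pi • J) *ᵥ (v - P *ᵥ v) = (0 : ℝ) • (v - P *ᵥ v) := by
      rw [mulVec_sub, mulVec_mulVec, smul_mul_assoc, hJP, sub_self, zero_smul]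
    rw [exp_mulVec_eigen h0, Real.exp_zero, one_smul]
  calc NormedSpace.exp (Real.pi • J) *ᵥ v
      = NormedSpace.exp (Real.pi • J) *ᵥ (P *ᵥ v) +
        NormedSpace.exp (Real.pi • J) *ᵥ (v - P *ᵥ v) := by rw [← mulVec_add]; congr 1; abel
    _ = _ := by rw [h1, h2, sub_mulVec, one_mulVec, smul_mulVec]; module

/-- `X` and `J` live on complementary subspaces and hence commute. This absorbs the reflection of
`exists_exp_mul_reflection` into the exponent. -/
theorem exp_add_pi_smul {X J P : Matrix ι ι ℝ} (hXP : X * P = 0) (hPX : P * X = 0)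
    (hJ : J * J = -P) (hJP : J * P = J) (hPJ : P * J = J) (hP : P * P = P) :
    NormedSpace.exp (X + Real.pi • J) = NormedSpace.exp X * (1 - (2 : ℝ) • P) := by
  have h1 : X * J = 0 := by rw [← hPJ, ← mul_assoc, hXP, zero_mul]
  have h2 : J * X = 0 := by rw [← hJP, mul_assoc, hPX, mul_zero]
  have h : Commute X (Real.pi • J) := Commute.smul_right (h1.trans h2.symm) _
  rw [Matrix.exp_add_of_commute _ _ h, exp_pi_smul_of_sq hJ hJP hP]

/-- A symmetric projection of even rank is `-J ^ 2` for a skew matrix `J` living on its range. -/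
theorem exists_skew_sq_eq_neg {P : Matrix ι ι ℝ} (hPs : Pᵀ = P) (hP : P * P = P)
    (hdet : 0 < (1 - (2 : ℝ) • P).det) :
    ∃ J : Matrix ι ι ℝ, Jᵀ = -J ∧ J * J = -P ∧ J * P = J := by
  have hH : P.IsHermitian := by rwa [IsHermitian, conjTranspose_eq_transpose_of_trivial]
  set U : Matrix ι ι ℝ := (hH.eigenvectorUnitary : Matrix ι ι ℝ) with hU
  set e := hH.eigenvalues with he
  have hUU : Uᵀ * U = 1 := by
    have := Unitary.coe_star_mul_self hH.eigenvectorUnitary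
    rwa [star_eq_conjTranspose, conjTranspose_eq_transpose_of_trivial] at this
  have hUU' : U * Uᵀ = 1 := mul_eq_one_comm.1 hUU
  have hPU : P = U * diagonal e * Uᵀ := by
    have := hH.spectral_theorem
    rwa [Unitary.conjStarAlgAut_apply, star_eq_conjTranspose,
      conjTranspose_eq_transpose_of_trivial] at this
  have hconj : ∀ A B : Matrix ι ι ℝ, U * A * Uᵀ * (U * B * Uᵀ) = U * (A * B) * Uᵀ := by
    intro A B
    calc U * A * Uᵀ * (U * B * Uᵀ) = U * A * (Uᵀ * U) * B * Uᵀ := by noncomm_ring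
      _ = _ := by rw [hUU, mul_one, mul_assoc U]
  have hdiag : Uᵀ * P * U = diagonal e := by
    calc Uᵀ * P * U = (Uᵀ * U) * diagonal e * (Uᵀ * U) := by rw [hPU]; noncomm_ring
      _ = _ := by rw [hUU, one_mul, mul_one]
  have he2 : ∀ i, e i = 0 ∨ e i = 1 := by
    intro i
    have h1 : diagonal e * diagonal e = diagonal e := by
      calc diagonal e * diagonal e = Uᵀ * (P * (U * Uᵀ) * P) * U := by
            rw [← hdiag]; noncomm_ring
        _ = _ := by rw [hUU', mul_one, hP, hdiag]
    rw [diagonal_mul_diagonal] at h1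
    have h2 := congrFun (diagonal_injective h1) i
    have h3 : e i * (e i - 1) = 0 := by linarith
    rcases mul_eq_zero.1 h3 with h | h
    · exact Or.inl h
    · exact Or.inr (by linarith)
  have hdet2 : (1 - (2 : ℝ) • P).det = ∏ i, (1 - 2 * e i) := by
    have : 1 - (2 : ℝ) • P = U * (diagonal fun i => 1 - 2 * e i) * Uᵀ := by
      have h4 : (diagonal fun i => 1 - 2 * e i) = 1 - (2 : ℝ) • diagonal e := by
        ext i j
        by_cases h : i = j
        · subst h; simp
        · simp [h]
      rw [h4, mul_sub, sub_mul, mul_one, hUU', Matrix.mul_smul, Matrix.smul_mul, ← hPU]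
    rw [this, det_mul_right_comm, hUU', one_mul, det_diagonal]
  -- Each eigenvalue `1` of `P` contributes a factor `-1` to the determinant, each eigenvalue `0` a
  -- factor `1`.
  have heven : Even (Fintype.card {i // e i = 1}) := by
    by_contra hodd
    rw [Nat.not_even_iff_odd] at hodd
    have h5 : ∏ i, (1 - 2 * e i) = (-1) ^ Fintype.card {i // e i = 1} := by
      rw [Fintype.card_subtype, ← Finset.prod_const, Finset.prod_filter]
      refine Finset.prod_congr rfl fun i _ => ?_
      rcases he2 i with h | h <;> simp [h]
      norm_num
    rw [hdet2, h5, hodd.neg_one_pow] at hdet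
    linarith
  obtain ⟨k, hk⟩ := heven
  -- Pairing up the eigenvectors of eigenvalue `1` makes room for the standard complex structure.
  let f : {i // e i = 1} ≃ Fin k ⊕ Fin k := Fintype.equivOfCardEq (by simp [hk])
  let g : ι ≃ (Fin k ⊕ Fin k) ⊕ {i // ¬ e i = 1} :=
    (Equiv.sumCompl fun i => e i = 1).symm.trans (Equiv.sumCongr f (Equiv.refl _))
  let E : Matrix ((Fin k ⊕ Fin k) ⊕ {i // ¬ e i = 1}) ((Fin k ⊕ Fin k) ⊕ {i // ¬ e i = 1}) ℝ :=
    fromBlocks 1 0 0 0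
  let F : Matrix ((Fin k ⊕ Fin k) ⊕ {i // ¬ e i = 1}) ((Fin k ⊕ Fin k) ⊕ {i // ¬ e i = 1}) ℝ :=
    fromBlocks (Matrix.J (Fin k) ℝ) 0 0 0
  have hE : diagonal e = E.submatrix g g := by
    have h6 : E = diagonal (Sum.elim 1 0) := by
      rw [← fromBlocks_diagonal]
      simp [E]
    rw [h6, submatrix_diagonal_equiv]
    congr 1
    funext i
    by_cases h : e i = 1
    · simp [g, h]
    · simp [g, (he2 i).resolve_right h]
  have hneg : ∀ G : Matrix ((Fin k ⊕ Fin k) ⊕ {i // ¬ e i = 1})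
      ((Fin k ⊕ Fin k) ⊕ {i // ¬ e i = 1}) ℝ, (-G).submatrix g g = -(G.submatrix g g) :=
    fun _ => rfl
  have hFF : F * F = -E := by
    simp only [F, E, fromBlocks_multiply, Matrix.J_squared, fromBlocks_neg]
    simp
  have hFE : F * E = F := by simp [F, E, fromBlocks_multiply]
  have hFT : Fᵀ = -F := by
    simp [F, fromBlocks_transpose, fromBlocks_neg, Matrix.J_transpose]
  refine ⟨U * F.submatrix g g * Uᵀ, ?_, ?_, ?_⟩
  · rw [transpose_mul, transpose_mul, transpose_transpose, transpose_submatrix, hFT,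
      hneg, neg_mul, mul_neg, mul_assoc]
  · rw [hconj, submatrix_mul_equiv, hFF, hneg, hPU, hE, mul_neg, neg_mul]
  · conv_lhs => rw [hPU, hconj, hE, submatrix_mul_equiv, hFE]

/-- The exponential map of the special orthogonal group is surjective. -/
theorem exists_skew_exp_eq {O : Matrix ι ι ℝ} (hO : Oᵀ * O = 1) (hdet : 0 < O.det) :
    ∃ X : Matrix ι ι ℝ, Xᵀ = -X ∧ NormedSpace.exp X = O := by
  obtain ⟨X, P, hX, hPs, hP, hXP, hPX, hOe, -⟩ := exists_exp_mul_reflection hO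
  obtain ⟨J, hJT, hJJ, hJP⟩ := exists_skew_sq_eq_neg hPs hP (by
    rw [hOe, det_mul] at hdet
    exact (pos_iff_pos_of_mul_pos hdet).1 (det_exp_pos X))
  have hPJ : P * J = J := by
    have := congrArg transpose hJP
    rwa [transpose_mul, hJT, hPs, mul_neg, neg_inj] at this
  refine ⟨X + Real.pi • J, ?_, ?_⟩
  · rw [transpose_add, transpose_smul, hX, hJT]; module
  · rw [exp_add_pi_smul hXP hPX hJJ hJP hPJ hP, ← hOe]

/-- The exponential map of the unitary group, viewed as the group of the orthogonal matrices that
commute with the complex structure `Ω`, is surjective. -/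
theorem exists_skew_commute_exp_eq {O W : Matrix ι ι ℝ} (hO : Oᵀ * O = 1) (hWT : Wᵀ = -W)
    (hWW : W * W = -1) (hOW : Commute W O) :
    ∃ X : Matrix ι ι ℝ, Xᵀ = -X ∧ Commute W X ∧ NormedSpace.exp X = O := by
  obtain ⟨X, P, hX, hPs, hP, hXP, hPX, hOe, hW⟩ := exists_exp_mul_reflection hO
  have hOW' : Commute W Oᵀ := by
    have h := congrArg transpose hOW.eq
    rw [transpose_mul, transpose_mul, hWT, mul_neg, neg_mul, neg_inj] at h
    exact h.symm
  obtain ⟨hWX, hWP⟩ := hW W hOW hOW'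
  -- The complex structure on the range of `P` is the restriction of `W`, so no determinant
  -- condition is needed and the exponent still commutes with `W`.
  have hJP : W * P * P = W * P := by rw [mul_assoc, hP]
  have hPJ : P * (W * P) = W * P := by rw [hWP.eq, ← mul_assoc, hP]
  have hJJ : W * P * (W * P) = -P := by rw [mul_assoc, hPJ, ← mul_assoc, hWW, neg_one_mul]
  refine ⟨X + Real.pi • (W * P), ?_, ?_, ?_⟩
  · rw [transpose_add, transpose_smul, hX, transpose_mul, hPs, hWT, mul_neg, hWP.eq]; module
  · exact hWX.add_right (((Commute.refl W).mul_right hWP).smul_right _)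
  · rw [exp_add_pi_smul hXP hPX hJJ hJP hPJ hP, ← hOe]

/-- Conjugation by `W` takes `Y` to `-Y`, hence `exp Y` to its inverse. -/
theorem exp_mul_mul_exp_of_anticommute {Y W : Matrix ι ι ℝ} (hW : IsUnit W)
    (h : Y * W = -(W * Y)) : NormedSpace.exp Y * W * NormedSpace.exp Y = W := by
  have hd : IsUnit W.det := (isUnit_iff_isUnit_det W).1 hW
  have h1 : W * -Y * W⁻¹ = Y := by
    rw [mul_neg, ← h, mul_nonsing_inv_cancel_right _ _ hd]
  have h2 : NormedSpace.exp Y * W = W * NormedSpace.exp (-Y) := by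
    rw [← h1, Matrix.exp_conj _ _ hW, nonsing_inv_mul_cancel_right _ _ hd, h1]
  have h3 : NormedSpace.exp (-Y) * NormedSpace.exp Y = 1 := by
    rw [← Matrix.exp_add_of_commute _ _ (Commute.neg_left (Commute.refl Y)), neg_add_cancel,
      NormedSpace.exp_zero]
  rw [h2, mul_assoc, h3, mul_one]

/-- The polar decomposition of the symplectic group, in exponential form. -/
theorem exists_exp_mul_exp_of_symplectic {D W : Matrix ι ι ℝ} (hWT : Wᵀ = -W) (hWW : W * W = -1)
    (hD : Dᵀ * W * D = W) :
    ∃ X Y : Matrix ι ι ℝ, Xᵀ = -X ∧ Xᵀ * W + W * X = 0 ∧ Yᵀ = Y ∧ Yᵀ * W + W * Y = 0 ∧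
      D = NormedSpace.exp X * NormedSpace.exp Y := by
  have hWi : -W * W = 1 := by rw [neg_mul, hWW, neg_neg]
  have hWu : IsUnit W := IsUnit.of_mul_eq_one_right (-W) hWi
  have hDl : -W * Dᵀ * W * D = 1 := by
    rw [← hWi, mul_assoc, mul_assoc, ← mul_assoc Dᵀ, hD]
  have hDu : IsUnit D := IsUnit.of_mul_eq_one_right _ hDl
  have hDr : D * (-W * Dᵀ * W) = 1 := mul_eq_one_comm.1 hDl
  have hDWD : D * W * Dᵀ = W := by
    calc D * W * Dᵀ = -(D * (W * Dᵀ) * -1) := by noncomm_ring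
      _ = D * (-W * Dᵀ * W) * W := by rw [← hWW]; noncomm_ring
      _ = W := by rw [hDr, one_mul]
  obtain ⟨Y, hYT, hYY, hYJ⟩ := exists_symm_exp_mul_self hDu
  -- `Dᵀ * D` preserves the form `W` as well, so its half logarithm anticommutes with `W`.
  have hYW : Y * W = -(W * Y) := hYJ W (by
    calc Dᵀ * D * W * (Dᵀ * D) = Dᵀ * (D * W * Dᵀ) * D := by noncomm_ring
      _ = W := by rw [hDWD, hD])
  have hEE : NormedSpace.exp Y * NormedSpace.exp (-Y) = 1 := by
    rw [← Matrix.exp_add_of_commute _ _ (Commute.neg_right (Commute.refl Y)), add_neg_cancel,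
      NormedSpace.exp_zero]
  have hEE' : NormedSpace.exp (-Y) * NormedSpace.exp Y = 1 := mul_eq_one_comm.1 hEE
  have hET : (NormedSpace.exp (-Y))ᵀ = NormedSpace.exp (-Y) := by
    rw [← Matrix.exp_transpose, transpose_neg, hYT]
  have hYW' : -Y * W = -(W * -Y) := by rw [neg_mul, hYW, mul_neg]
  have hO : (D * NormedSpace.exp (-Y))ᵀ * (D * NormedSpace.exp (-Y)) = 1 := by
    rw [transpose_mul, hET]
    calc NormedSpace.exp (-Y) * Dᵀ * (D * NormedSpace.exp (-Y))
        = NormedSpace.exp (-Y) * (Dᵀ * D) * NormedSpace.exp (-Y) := by noncomm_ring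
      _ = (NormedSpace.exp (-Y) * NormedSpace.exp Y) *
          (NormedSpace.exp Y * NormedSpace.exp (-Y)) := by rw [← hYY]; noncomm_ring
      _ = 1 := by rw [hEE, hEE', one_mul]
  have hOW : (D * NormedSpace.exp (-Y))ᵀ * W * (D * NormedSpace.exp (-Y)) = W := by
    rw [transpose_mul, hET]
    calc NormedSpace.exp (-Y) * Dᵀ * W * (D * NormedSpace.exp (-Y))
        = NormedSpace.exp (-Y) * (Dᵀ * W * D) * NormedSpace.exp (-Y) := by noncomm_ring
      _ = W := by rw [hD, exp_mul_mul_exp_of_anticommute hWu hYW']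
  -- An orthogonal matrix preserving the form `W` commutes with `W`.
  have hcomm : Commute W (D * NormedSpace.exp (-Y)) := by
    have hO' := mul_eq_one_comm.1 hO
    calc W * (D * NormedSpace.exp (-Y)) = (D * NormedSpace.exp (-Y)) *
          (D * NormedSpace.exp (-Y))ᵀ * W * (D * NormedSpace.exp (-Y)) := by rw [hO', one_mul]
      _ = (D * NormedSpace.exp (-Y)) *
          ((D * NormedSpace.exp (-Y))ᵀ * W * (D * NormedSpace.exp (-Y))) := by noncomm_ring
      _ = _ := by rw [hOW]
  obtain ⟨X, hXT, hXW, hX⟩ := exists_skew_commute_exp_eq hO hWT hWW hcomm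
  refine ⟨X, Y, hXT, ?_, hYT, ?_, ?_⟩
  · rw [hXT, hXW.eq, neg_mul, neg_add_cancel]
  · rw [hYT, hYW, neg_add_cancel]
  · rw [hX, mul_assoc, hEE', mul_one]

end RealLog

/-! ### Exponential and logarithm of nilpotent elements -/

section NilpotentLog

open Polynomial

theorem nilpotent_exp_eq {A : Type*} [Ring A] [Algebra ℚ A] {a : A} (ha : IsNilpotent a) :
    ∃ e, IsNilpotent.exp a = 1 + a + a * a * e := by
  obtain ⟨n, hn⟩ := ha
  have hn2 : a ^ (n + 1 + 1) = 0 := pow_eq_zero_of_le (by omega) hn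
  refine ⟨∑ i ∈ Finset.range n, (((i + 2).factorial : ℚ)⁻¹) • a ^ i, ?_⟩
  rw [IsNilpotent.exp_eq_sum hn2, Finset.sum_range_succ', Finset.sum_range_succ', Finset.mul_sum]
  have : ∀ i, ((i + 1 + 1).factorial : ℚ)⁻¹ • a ^ (i + 1 + 1) =
      a * a * ((i + 2).factorial : ℚ)⁻¹ • a ^ i := fun i => by
    rw [mul_smul_comm, pow_succ', pow_succ', mul_assoc]
  simp only [this]
  simp only [zero_add, Nat.factorial, Nat.cast_one, inv_one, one_smul, pow_one, pow_zero, mul_one]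
  abel

/-- Successive approximation: an error `1 + w` with `w = u ^ (k + 1) * d` is multiplied by `exp
(-w)`, which leaves only terms divisible by `w ^ 2`, until the nilpotency of `u` ends the process.
-/
theorem exists_nilpotent_exp_mul_eq {B : Type*} [CommRing B] [Algebra ℚ B] {u : B}
    (hu : IsNilpotent u) : ∃ c, IsNilpotent.exp (u * c) = 1 + u := by
  have hnil : ∀ c, IsNilpotent (u * c) := fun c => (Commute.all u c).isNilpotent_mul_right hu
  have key : ∀ k : ℕ, ∃ c d, IsNilpotent.exp (-(u * c)) * (1 + u) = 1 + u ^ (k + 1) * d := by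
    intro k
    induction k with
    | zero => exact ⟨0, 1, by simp⟩
    | succ k ih =>
      obtain ⟨c, d, h⟩ := ih
      have hw : u ^ (k + 1) * d = u * (u ^ k * d) := by ring
      obtain ⟨e, he⟩ := nilpotent_exp_eq (hnil (u ^ k * d)).neg
      rw [← hw] at he
      -- From `(1 + w) * (1 - w + w ^ 2 * e) = 1 + w ^ 2 * (-1 + e + w * e)`, with one factor `u ^
      -- (k + 2)` split off from `w ^ 2`.
      refine ⟨c + u ^ k * d, u ^ k * d * d * (-1 + e + u ^ (k + 1) * d * e), ?_⟩
      rw [mul_add u, neg_add, IsNilpotent.exp_add_of_commute (Commute.all _ _) (hnil c).neg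
        (hnil _).neg, mul_right_comm, h, ← hw, he]
      ring
  obtain ⟨n, hn⟩ := hu
  obtain ⟨c, d, h⟩ := key n
  rw [pow_succ, hn, zero_mul, zero_mul, add_zero] at h
  refine ⟨c, ?_⟩
  calc IsNilpotent.exp (u * c)
      = IsNilpotent.exp (u * c) * IsNilpotent.exp (-(u * c)) * (1 + u) := by
        rw [mul_assoc, h, mul_one]
    _ = 1 + u := by rw [IsNilpotent.exp_mul_exp_neg_self (hnil c), one_mul]

variable {A : Type*} [Ring A] [Algebra ℚ A]

/-- A unipotent element has a logarithm which is a polynomial in it. -/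
theorem exists_aeval_nilpotent_exp_eq [Algebra ℝ A] {u : A} (hu : IsNilpotent u) :
    ∃ p : ℝ[X], IsNilpotent.exp (u * aeval u p) = 1 + u := by
  obtain ⟨n, hn⟩ := hu
  -- The commutative case is solved in the universal ring `ℝ[X] / (X ^ n)` and carried over by `X ↦
  -- u`.
  let I : Ideal ℝ[X] := Ideal.span {X ^ n}
  have hX : IsNilpotent (Ideal.Quotient.mk I X) := by
    refine ⟨n, ?_⟩
    rw [← map_pow, Ideal.Quotient.eq_zero_iff_mem]
    exact Ideal.subset_span rfl
  obtain ⟨c, hc⟩ := exists_nilpotent_exp_mul_eq hX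
  obtain ⟨p, rfl⟩ := Ideal.Quotient.mk_surjective c
  let f : ℝ[X] ⧸ I →+* A := Ideal.Quotient.lift I (aeval u : ℝ[X] →ₐ[ℝ] A).toRingHom (by
    intro a ha
    obtain ⟨b, rfl⟩ := Ideal.mem_span_singleton.1 ha
    simp [hn])
  have hf : ∀ q, f (Ideal.Quotient.mk I q) = aeval u q := fun q => rfl
  refine ⟨p, ?_⟩
  have h := congrArg f hc
  rw [IsNilpotent.map_exp ((Commute.all _ _).isNilpotent_mul_right hX), map_mul, map_add, map_one,
    hf, hf, aeval_X] at h
  exact h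

/-- The relation `s + s * s * e = 0`, multiplied by a power of `s`, lowers the nilpotency exponent
step by step. -/
theorem eq_zero_of_nilpotent_exp_eq_one {s : A} (hs : IsNilpotent s)
    (h : IsNilpotent.exp s = 1) : s = 0 := by
  obtain ⟨e, he⟩ := nilpotent_exp_eq hs
  have h0 : s + s * s * e = 0 := by
    rw [h, add_assoc] at he
    exact (left_eq_add.1 he)
  have key : ∀ j : ℕ, s ^ (j + 1) = 0 → s = 0 := by
    intro j
    induction j with
    | zero => intro h; simpa using h
    | succ j ih =>
      intro hj
      apply ih
      have h1 : s ^ j * (s + s * s * e) = s ^ (j + 1) + s ^ (j + 1 + 1) * e := by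
        rw [mul_add, pow_succ, pow_succ, pow_succ]; simp only [mul_assoc]
      rwa [h0, mul_zero, hj, zero_mul, add_zero, eq_comm] at h1
  obtain ⟨n, hn⟩ := hs
  exact key n (pow_eq_zero_of_le (Nat.le_succ n) hn)

theorem commute_nilpotent_exp {a : A} : Commute a (IsNilpotent.exp a) :=
  Commute.sum_right _ _ _ fun i _ => ((Commute.refl a).pow_right i).smul_right _

/-- The exponential map is injective on nilpotent elements. -/
theorem eq_of_nilpotent_exp_eq [Algebra ℝ A] {a b : A} (ha : IsNilpotent a) (hb : IsNilpotent b)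
    (h : IsNilpotent.exp a = IsNilpotent.exp b) : a = b := by
  set u := IsNilpotent.exp a - 1 with hu
  have hun : IsNilpotent u := IsNilpotent.isNilpotent_exp_sub_one ha
  obtain ⟨p, hp⟩ := exists_aeval_nilpotent_exp_eq hun
  have hup : Commute u (u * aeval u p) := by
    have := (Commute.all X (X * p)).map (aeval u : ℝ[X] →ₐ[ℝ] A)
    simpa using this
  have hz : IsNilpotent (u * aeval u p) := by
    have := (Commute.all X p).map (aeval u : ℝ[X] →ₐ[ℝ] A)
    rw [aeval_X] at this
    exact this.isNilpotent_mul_right hun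
  -- A nilpotent logarithm `c` commutes with `u = exp c - 1`, hence with the polynomial logarithm;
  -- the difference of the two is then nilpotent with exponential `1`.
  have key : ∀ c, IsNilpotent c → IsNilpotent.exp c = IsNilpotent.exp a → c = u * aeval u p := by
    intro c hc hca
    have hcu : Commute c u := by
      rw [hu, ← hca]
      exact commute_nilpotent_exp.sub_right (Commute.one_right c)
    have hcz : Commute c (u * aeval u p) := by
      refine hcu.mul_right ?_
      clear * - hcu
      induction p using Polynomial.induction_on' with
      | add p q hp hq => rw [map_add]; exact hp.add_right hq
      | monomial n a =>
        rw [aeval_monomial]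
        exact (Algebra.commute_algebraMap_right a c).mul_right (hcu.pow_right n)
    have h1 : IsNilpotent.exp (c - u * aeval u p) = 1 := by
      rw [sub_eq_add_neg, IsNilpotent.exp_add_of_commute hcz.neg_right hc hz.neg, hca]
      have : IsNilpotent.exp a = IsNilpotent.exp (u * aeval u p) := by rw [hp, hu]; abel
      rw [this, IsNilpotent.exp_mul_exp_neg_self hz]
    exact sub_eq_zero.1 (eq_zero_of_nilpotent_exp_eq_one
      (hcz.isNilpotent_sub hc hz) h1)
  exact (key a ha rfl).trans (key b hb h.symm).symm

theorem exp_eq_nilpotent_exp {A : Type*} [Ring A] [Algebra ℚ A] [TopologicalSpace A]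
    [IsTopologicalRing A] [T2Space A] {a : A} (ha : IsNilpotent a) :
    NormedSpace.exp a = IsNilpotent.exp a := by
  obtain ⟨n, hn⟩ := ha
  rw [NormedSpace.exp_eq_tsum ℚ, IsNilpotent.exp_eq_sum hn]
  refine tsum_eq_sum fun k hk => ?_
  rw [pow_eq_zero_of_le (by simpa using hk) hn, smul_zero]

end NilpotentLog

/-! ### Nilpotency of the kernel of the body map -/

section BodyNilpotent

open ExteriorAlgebra

variable {N : ℕ}

theorem exteriorPower_succ_eq_bot : (⋀[ℝ]^(N + 1) (Fin N → ℝ)) = ⊥ := by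
  rw [← ιMulti_span_fixedDegree, Submodule.span_eq_bot]
  rintro _ ⟨v, rfl⟩
  refine AlternatingMap.map_linearDependent _ v fun h => ?_
  have := h.fintype_card_le_finrank
  simp at this

/-- The span of the products of generators with arbitrary elements. -/
abbrev positivePart (N : ℕ) : Submodule ℝ (Grassmann N) :=
  LinearMap.range (ι ℝ : (Fin N → ℝ) →ₗ[ℝ] Grassmann N) * ⊤

/-- Generators can be moved to the left, so the right ideal `positivePart` is two-sided. This is
what collects `k` generators at the front in `positivePart_pow_le`. -/
theorem top_mul_range_ι_le :
    ⊤ * LinearMap.range (ι ℝ : (Fin N → ℝ) →ₗ[ℝ] Grassmann N) ≤ positivePart N := by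
  rw [Submodule.mul_le]
  rintro x - _ ⟨v, rfl⟩
  induction x using ExteriorAlgebra.induction generalizing v with
  | algebraMap r =>
    rw [Algebra.commutes]
    exact Submodule.mul_mem_mul ⟨v, rfl⟩ trivial
  | ι x => exact Submodule.mul_mem_mul ⟨x, rfl⟩ trivial
  | add a b ha hb => rw [add_mul]; exact add_mem (ha v) (hb v)
  | mul a b ha hb =>
    rw [mul_assoc]
    have h : ∀ y ∈ positivePart N, a * y ∈ positivePart N := by
      intro y hy
      induction hy using Submodule.mul_induction_on' with
      | mem_mul_mem w hw z _ =>
        obtain ⟨w, rfl⟩ := hw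
        rw [← mul_assoc]
        have := Submodule.mul_mem_mul (ha w) (Submodule.mem_top (x := z) (R := ℝ))
        rw [positivePart, mul_assoc] at this
        exact (mul_le_mul' le_rfl le_top : _ ≤ positivePart N) this
      | add x _ y _ hx hy => rw [mul_add]; exact add_mem hx hy
    exact h _ (hb v)

theorem positivePart_pow_le (k : ℕ) :
    positivePart N ^ k ≤
      LinearMap.range (ι ℝ : (Fin N → ℝ) →ₗ[ℝ] Grassmann N) ^ k * ⊤ := by
  have htop : (⊤ : Submodule ℝ (Grassmann N)) * ⊤ ≤ ⊤ := le_top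
  induction k with
  | zero => simp
  | succ k ih =>
    calc positivePart N ^ (k + 1) = positivePart N ^ k * positivePart N := pow_succ _ _
      _ ≤ (LinearMap.range (ι ℝ) ^ k * ⊤) * (LinearMap.range (ι ℝ) * ⊤) := by gcongr
      _ = LinearMap.range (ι ℝ) ^ k * (⊤ * LinearMap.range (ι ℝ)) * ⊤ := by
        simp only [mul_assoc]
      _ ≤ LinearMap.range (ι ℝ) ^ k * (LinearMap.range (ι ℝ) * ⊤) * ⊤ := by
        
        exact mul_le_mul' (mul_le_mul' le_rfl top_mul_range_ι_le) le_rfl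
      _ = LinearMap.range (ι ℝ) ^ (k + 1) * (⊤ * ⊤) := by simp only [pow_succ, mul_assoc]
      _ ≤ _ := by gcongr

theorem body_ι (v : Fin N → ℝ) : body N (ι ℝ v) = 0 := by
  simp [body, algebraMapInv]

theorem sub_body_mem_positivePart (x : Grassmann N) :
    x - algebraMap ℝ _ (body N x) ∈ positivePart N := by
  induction x using ExteriorAlgebra.induction with
  | algebraMap r => simp
  | ι x =>
    rw [body_ι, map_zero, sub_zero, ← mul_one (ι ℝ x)]
    exact Submodule.mul_mem_mul ⟨x, rfl⟩ trivial
  | add a b ha hb =>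
    rw [map_add, map_add, add_sub_add_comm]; exact add_mem ha hb
  | mul a b ha hb =>
    have h : a * b - algebraMap ℝ _ (body N (a * b)) = (a - algebraMap ℝ _ (body N a)) * b +
        body N a • (b - algebraMap ℝ _ (body N b)) := by
      rw [map_mul, map_mul, Algebra.smul_def]; noncomm_ring
    rw [h]
    refine add_mem ?_ (Submodule.smul_mem _ _ hb)
    have := Submodule.mul_mem_mul ha (Submodule.mem_top (x := b) (R := ℝ))
    rw [positivePart, mul_assoc] at this
    exact (mul_le_mul' le_rfl le_top : _ ≤ positivePart N) this

/-- A matrix over the Grassmann algebra all of whose entries have body zero is nilpotent. -/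
theorem isNilpotent_of_body_eq_zero {ι' : Type*} [Fintype ι'] [DecidableEq ι']
    {Z : Matrix ι' ι' (Grassmann N)} (hZ : ∀ i j, body N (Z i j) = 0) : IsNilpotent Z := by
  have hmem : ∀ i j, Z i j ∈ positivePart N := fun i j => by
    have := sub_body_mem_positivePart (Z i j)
    rwa [hZ, map_zero, sub_zero] at this
  have hpow : ∀ k i j, (Z ^ k) i j ∈ positivePart N ^ k := by
    intro k
    induction k with
    | zero =>
      intro i j
      rw [pow_zero, pow_zero, one_apply]
      split_ifs
      · exact Submodule.one_le.1 le_rfl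
      · exact zero_mem _
    | succ k ih =>
      intro i j
      rw [pow_succ, pow_succ, mul_apply]
      exact sum_mem fun l _ => Submodule.mul_mem_mul (ih i l) (hmem l j)
  -- A product of `N + 1` vectors of an `N`-dimensional space vanishes in the exterior algebra.
  refine ⟨N + 1, ?_⟩
  ext i j
  have h := positivePart_pow_le _ (hpow (N + 1) i j)
  rw [show LinearMap.range (ι ℝ : (Fin N → ℝ) →ₗ[ℝ] Grassmann N) ^ (N + 1) = ⊥ from
    exteriorPower_succ_eq_bot, Submodule.bot_mul] at h
  simpa using h

theorem body_of_mem_oddPart {x : Grassmann N} (hx : x ∈ oddPart N) : body N x = 0 := by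
  induction x, hx using CliffordAlgebra.odd_induction with
  | ι v => exact body_ι v
  | add x y _ _ hx hy => exact (map_add _ x y).trans (by rw [hx, hy, add_zero])
  | ι_mul_ι_mul v w x _ hx =>
    exact (map_mul (body N) _ x).trans (by rw [hx, mul_zero])

end BodyNilpotent

/-! ### Supertranspose, real block matrices and bodies of supermatrices -/

section Supermatrix

variable {N : ℕ} {ι κ : Type} [Fintype ι] [Fintype κ] [DecidableEq ι] [DecidableEq κ]

theorem odd_anticommute {a b : Grassmann N} (ha : a ∈ oddPart N) (hb : b ∈ oddPart N) :
    a * b = -(b * a) := by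
  have hι : ∀ v w : Fin N → ℝ, ExteriorAlgebra.ι ℝ v * ExteriorAlgebra.ι ℝ w =
      -(ExteriorAlgebra.ι ℝ w * ExteriorAlgebra.ι ℝ v) := fun v w =>
    eq_neg_of_add_eq_zero_left (ExteriorAlgebra.ι_add_mul_swap v w)
  have hιι : ∀ (v w : Fin N → ℝ) (x : Grassmann N),
      ExteriorAlgebra.ι ℝ v * ExteriorAlgebra.ι ℝ w * x =
        x * (ExteriorAlgebra.ι ℝ v * ExteriorAlgebra.ι ℝ w) := fun v w x =>
    even_commute (CliffordAlgebra.ι_mul_ι_mem_evenOdd_zero _ v w) x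
  have h1 : ∀ v : Fin N → ℝ, ExteriorAlgebra.ι ℝ v * b = -(b * ExteriorAlgebra.ι ℝ v) := by
    intro v
    induction b, hb using CliffordAlgebra.odd_induction with
    | ι w => exact hι v w
    | add x y _ _ hx hy =>
      have : ∀ z x y : Grassmann N, z * x = -(x * z) → z * y = -(y * z) →
        z * (x + y) = -((x + y) * z) := fun z x y h h' => by
          rw [mul_add, add_mul, h, h', neg_add]
      exact this _ x y hx hy
    | ι_mul_ι_mul w w' x _ hx =>
      have : ∀ z e x : Grassmann N, e * z = z * e → z * x = -(x * z) →
        z * (e * x) = -((e * x) * z) := fun z e x h h' => by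
          rw [← mul_assoc, ← h, mul_assoc, h', mul_neg, mul_assoc]
      exact this _ _ x (hιι w w' _) hx
  induction a, ha using CliffordAlgebra.odd_induction with
  | ι v => exact h1 v
  | add x y _ _ hx hy =>
    have : ∀ x y : Grassmann N, x * b = -(b * x) → y * b = -(b * y) →
      (x + y) * b = -(b * (x + y)) := fun x y h h' => by
        rw [mul_add, add_mul, h, h', neg_add]
    exact this x y hx hy
  | ι_mul_ι_mul w w' x _ hx =>
    have : ∀ e x : Grassmann N, e * b = b * e → x * b = -(b * x) →
      (e * x) * b = -(b * (e * x)) := fun e x h h' => by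
        rw [mul_assoc, h', mul_neg, ← mul_assoc, h, mul_assoc]
    exact this _ x (hιι w w' _) hx

theorem transpose_mul_of_commute {R α β γ : Type*} [Ring R] [Fintype β] {A : Matrix α β R}
    {B : Matrix β γ R} (h : ∀ i j k, A i j * B j k = B j k * A i j) : (A * B)ᵀ = Bᵀ * Aᵀ := by
  ext i j
  simp only [transpose_apply, mul_apply]
  exact Finset.sum_congr rfl fun k _ => h _ _ _

theorem transpose_mul_of_anticommute {R α β γ : Type*} [Ring R] [Fintype β] {A : Matrix α β R}
    {B : Matrix β γ R} (h : ∀ i j k, A i j * B j k = -(B j k * A i j)) :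
    (A * B)ᵀ = -(Bᵀ * Aᵀ) := by
  ext i j
  rw [neg_apply]
  simp only [transpose_apply, mul_apply, ← Finset.sum_neg_distrib]
  exact Finset.sum_congr rfl fun k _ => h _ _ _

theorem supertranspose_fromBlocks (A : Matrix ι ι (Grassmann N)) (B : Matrix ι κ (Grassmann N))
    (C : Matrix κ ι (Grassmann N)) (D : Matrix κ κ (Grassmann N)) :
    supertranspose (fromBlocks A B C D) = fromBlocks Aᵀ Cᵀ (-Bᵀ) Dᵀ := by
  simp [supertranspose]

theorem supertranspose_add (M L : Matrix (ι ⊕ κ) (ι ⊕ κ) (Grassmann N)) :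
    supertranspose (M + L) = supertranspose M + supertranspose L := by
  rw [← fromBlocks_toBlocks M, ← fromBlocks_toBlocks L, fromBlocks_add]
  simp only [supertranspose_fromBlocks, fromBlocks_add, transpose_add, neg_add]

/-- The sign in `-Bᵀ` compensates for the sign of exchanging two odd entries; all other products
have an even, hence central, factor. -/
theorem supertranspose_mul {M L : Matrix (ι ⊕ κ) (ι ⊕ κ) (Grassmann N)}
    (hM : M ∈ superMat N ι κ) (hL : L ∈ superMat N ι κ) :
    supertranspose (M * L) = supertranspose L * supertranspose M := by
  obtain ⟨hA, hB, hC, hD⟩ := hM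
  obtain ⟨hA', hB', hC', hD'⟩ := hL
  rw [← fromBlocks_toBlocks M, ← fromBlocks_toBlocks L, fromBlocks_multiply]
  simp only [supertranspose_fromBlocks, fromBlocks_multiply, transpose_add]
  rw [transpose_mul_of_commute (A := M.toBlocks₁₁) (B := L.toBlocks₁₁)
      fun i j k => even_commute (hA i j) _,
    transpose_mul_of_commute (A := M.toBlocks₁₁) (B := L.toBlocks₁₂)
      fun i j k => even_commute (hA i j) _,
    transpose_mul_of_commute (A := M.toBlocks₂₂) (B := L.toBlocks₂₁)
      fun i j k => even_commute (hD i j) _,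
    transpose_mul_of_commute (A := M.toBlocks₂₂) (B := L.toBlocks₂₂)
      fun i j k => even_commute (hD i j) _,
    transpose_mul_of_commute (A := M.toBlocks₁₂) (B := L.toBlocks₂₂)
      fun i j k => (even_commute (hD' j k) _).symm,
    transpose_mul_of_commute (A := M.toBlocks₂₁) (B := L.toBlocks₁₁)
      fun i j k => (even_commute (hA' j k) _).symm,
    transpose_mul_of_anticommute (A := M.toBlocks₁₂) (B := L.toBlocks₂₁)
      fun i j k => odd_anticommute (hB i j) (hC' j k),
    transpose_mul_of_anticommute (A := M.toBlocks₂₁) (B := L.toBlocks₁₂)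
      fun i j k => odd_anticommute (hC i j) (hB' j k)]
  simp only [Matrix.mul_neg, Matrix.neg_mul, neg_add_rev, add_comm]

theorem supertranspose_one : supertranspose (1 : Matrix (ι ⊕ κ) (ι ⊕ κ) (Grassmann N)) = 1 := by
  rw [← fromBlocks_one, supertranspose_fromBlocks]
  simp

theorem supertranspose_pow {M : Matrix (ι ⊕ κ) (ι ⊕ κ) (Grassmann N)}
    (hM : M ∈ superMat N ι κ) (k : ℕ) : supertranspose (M ^ k) = supertranspose M ^ k := by
  induction k with
  | zero => rw [pow_zero, pow_zero, supertranspose_one]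
  | succ k ih => rw [pow_succ, supertranspose_mul (pow_mem hM k) hM, ih, pow_succ']

theorem supertranspose_nilpotent_exp {Z : Matrix (ι ⊕ κ) (ι ⊕ κ) (Grassmann N)}
    (hZ : Z ∈ superMat N ι κ) (hn : IsNilpotent Z) :
    IsNilpotent (supertranspose Z) ∧
      supertranspose (IsNilpotent.exp Z) = IsNilpotent.exp (supertranspose Z) := by
  let f : Matrix (ι ⊕ κ) (ι ⊕ κ) (Grassmann N) →+ Matrix (ι ⊕ κ) (ι ⊕ κ) (Grassmann N) :=
    AddMonoidHom.mk' supertranspose supertranspose_add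
  obtain ⟨n, hn⟩ := hn
  have hn' : supertranspose Z ^ n = 0 := by
    rw [← supertranspose_pow hZ, hn]
    exact map_zero f
  refine ⟨⟨n, hn'⟩, ?_⟩
  rw [IsNilpotent.exp_eq_sum hn, IsNilpotent.exp_eq_sum hn']
  change f _ = _
  rw [map_sum]
  refine Finset.sum_congr rfl fun k _ => ?_
  rw [map_rat_smul, ← supertranspose_pow hZ]
  rfl

theorem realBlocks_mul (A A' : Matrix ι ι ℝ) (D D' : Matrix κ κ ℝ) :
    realBlocks N A D * realBlocks N A' D' = realBlocks N (A * A') (D * D') := by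
  simp [realBlocks, fromBlocks_multiply, Matrix.map_mul]

theorem realBlocks_one : realBlocks N (1 : Matrix ι ι ℝ) (1 : Matrix κ κ ℝ) = 1 := by
  rw [realBlocks, Matrix.map_one _ (map_zero _) (map_one _),
    Matrix.map_one _ (map_zero _) (map_one _), fromBlocks_one]

theorem realBlocks_pow (A : Matrix ι ι ℝ) (D : Matrix κ κ ℝ) (k : ℕ) :
    realBlocks N A D ^ k = realBlocks N (A ^ k) (D ^ k) := by
  induction k with
  | zero => simp only [pow_zero, realBlocks_one]
  | succ k ih => rw [pow_succ, ih, realBlocks_mul, pow_succ, pow_succ]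

theorem supertranspose_realBlocks (A : Matrix ι ι ℝ) (D : Matrix κ κ ℝ) :
    supertranspose (realBlocks N A D) = realBlocks N Aᵀ Dᵀ := by
  simp [realBlocks, supertranspose_fromBlocks, transpose_map]

theorem realBlocks_mem (A : Matrix ι ι ℝ) (D : Matrix κ κ ℝ) :
    realBlocks N A D ∈ superMat N ι κ :=
  ⟨fun i j => (evenPart N).algebraMap_mem (A i j), fun _ _ => zero_mem (oddPart N),
    fun _ _ => zero_mem (oddPart N), fun i j => (evenPart N).algebraMap_mem (D i j)⟩

/-- The inclusion of the block-diagonal real matrices, as a linear map. -/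
def realBlocksLinear (N : ℕ) (ι κ : Type) [Fintype ι] [Fintype κ] [DecidableEq ι]
    [DecidableEq κ] :
    Matrix ι ι ℝ × Matrix κ κ ℝ →ₗ[ℝ] Matrix (ι ⊕ κ) (ι ⊕ κ) (Grassmann N) where
  toFun x := realBlocks N x.1 x.2
  map_add' x y := by
    ext (i | i) (j | j) <;> simp [realBlocks]
  map_smul' r x := by
    ext (i | i) (j | j)
    · exact map_smul (Algebra.linearMap ℝ (Grassmann N)) r _
    · exact (smul_zero r).symm
    · exact (smul_zero r).symm
    · exact map_smul (Algebra.linearMap ℝ (Grassmann N)) r _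

theorem continuous_realBlocksLinear : Continuous (realBlocksLinear N ι κ) := by
  have hc : Continuous (algebraMap ℝ (Grassmann N)) :=
    IsModuleTopology.continuous_of_linearMap (Algebra.linearMap ℝ (Grassmann N))
  refine continuous_matrix fun i j => ?_
  rcases i with i | i <;> rcases j with j | j
  · exact hc.comp (continuous_fst.matrix_elem i j)
  · exact continuous_const
  · exact continuous_const
  · exact hc.comp (continuous_snd.matrix_elem i j)

theorem exp_realBlocks (A : Matrix ι ι ℝ) (D : Matrix κ κ ℝ) :
    NormedSpace.exp (realBlocks N A D) =
      realBlocks N (NormedSpace.exp A) (NormedSpace.exp D) := by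
  have h : HasSum (fun k : ℕ => ((k.factorial : ℝ)⁻¹) • realBlocks N A D ^ k)
      (realBlocksLinear N ι κ (NormedSpace.exp A, NormedSpace.exp D)) := by
    have h0 := ((hasSum_exp_real A).prodMk (hasSum_exp_real D)).map (realBlocksLinear N ι κ)
      continuous_realBlocksLinear
    have h1 : ∀ k : ℕ, ((k.factorial : ℝ)⁻¹) • realBlocks N A D ^ k =
        realBlocksLinear N ι κ ((k.factorial : ℝ)⁻¹ • A ^ k, (k.factorial : ℝ)⁻¹ • D ^ k) := by
      intro k
      rw [← Prod.smul_mk, map_smul, realBlocks_pow]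
      rfl
    simp only [h1]
    exact h0
  rw [NormedSpace.exp_eq_tsum ℝ]
  exact h.tsum_eq

/-- The body of a matrix over the Grassmann algebra. -/
abbrev bodyMatrix (N : ℕ) (ι κ : Type) [Fintype ι] [Fintype κ] [DecidableEq ι] [DecidableEq κ] :
    Matrix (ι ⊕ κ) (ι ⊕ κ) (Grassmann N) →ₐ[ℝ] Matrix (ι ⊕ κ) (ι ⊕ κ) ℝ :=
  (body N).mapMatrix

theorem bodyMatrix_realBlocks (A : Matrix ι ι ℝ) (D : Matrix κ κ ℝ) :
    bodyMatrix N ι κ (realBlocks N A D) = fromBlocks A 0 0 D := by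
  ext (i | i) (j | j) <;> simp [realBlocks]

theorem exists_bodyMatrix_eq {M : Matrix (ι ⊕ κ) (ι ⊕ κ) (Grassmann N)}
    (hM : M ∈ superMat N ι κ) :
    ∃ A D, bodyMatrix N ι κ M = fromBlocks A 0 0 D ∧
      bodyMatrix N ι κ (supertranspose M) = fromBlocks Aᵀ 0 0 Dᵀ := by
  obtain ⟨-, hB, hC, -⟩ := hM
  refine ⟨M.toBlocks₁₁.map (body N), M.toBlocks₂₂.map (body N), ?_, ?_⟩
  · ext (i | i) (j | j)
    · rfl
    · exact body_of_mem_oddPart (hB i j)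
    · exact body_of_mem_oddPart (hC i j)
    · rfl
  · ext (i | i) (j | j)
    · rfl
    · exact body_of_mem_oddPart (hC j i)
    · exact (map_neg (body N) _).trans (by
        rw [transpose_apply, toBlocks₁₂, of_apply, body_of_mem_oddPart (hB j i)]; simp)
    · rfl

/-- The body is a ring homomorphism and kills `B D⁻¹ C`, whose factors `B` and `C` are odd. -/
theorem det_eq_det_of_sdet_eq_one {M : superMat N ι κ} (h : sdet M = 1)
    {A : Matrix ι ι ℝ} {D : Matrix κ κ ℝ} (hb : bodyMatrix N ι κ M.1 = fromBlocks A 0 0 D) :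
    A.det = D.det := by
  let β : evenPart N →ₐ[ℝ] ℝ := (body N).comp (evenPart N).val
  have hA : β (blockA M - blockBinvDC M).det = A.det := by
    rw [AlgHom.map_det]
    congr 1
    ext i j
    have h1 : body N (M.1 (Sum.inl i) (Sum.inl j)) = A i j :=
      congrFun (congrFun hb (Sum.inl i)) (Sum.inl j)
    have h2 : body N ((M.1.toBlocks₁₂ * ((blockD M)⁻¹).map (fun x => (x : Grassmann N)) *
        M.1.toBlocks₂₁) i j) = 0 := by
      rw [mul_apply, map_sum]
      refine Finset.sum_eq_zero fun k _ => ?_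
      rw [map_mul, body_of_mem_oddPart (x := M.1.toBlocks₂₁ k j) (M.2.2.2.1 k j), mul_zero]
    change body N (M.1 (Sum.inl i) (Sum.inl j) - _) = _
    rw [map_sub, h1]
    erw [h2]
    rw [sub_zero]
  have hD : β (blockD M).det = D.det := by
    rw [AlgHom.map_det]
    congr 1
    ext i j
    exact congrFun (congrFun hb (Sum.inr i)) (Sum.inr j)
  have h1 := congrArg β h
  rw [sdet, map_mul, map_one, hA] at h1
  by_cases hu : IsUnit (blockD M).det
  · have h2 := congrArg β (Ring.inverse_mul_cancel _ hu)
    rw [map_mul, map_one, hD] at h2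
    calc A.det = A.det * (β (Ring.inverse (blockD M).det) * D.det) := by rw [h2, mul_one]
      _ = D.det := by rw [← mul_assoc, h1, one_mul]
  -- If `det D` were not a unit, its `Ring.inverse` would be zero and so would `sdet M`.
  · rw [Ring.inverse_non_unit _ hu, map_zero, mul_zero] at h1
    exact absurd h1 zero_ne_one

end Supermatrix

/-! ### The decomposition of superrotations and its uniqueness -/

section Decomposition

variable {N m n : ℕ}

theorem Omega_transpose (n : ℕ) : (Omega n)ᵀ = -Omega n := by
  rw [Omega, blockDiagonal_transpose, ← blockDiagonal_neg]
  congr 1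
  funext _
  ext i j
  fin_cases i <;> fin_cases j <;> simp

theorem Omega_mul_self (n : ℕ) : Omega n * Omega n = -1 := by
  rw [Omega, ← blockDiagonal_mul, ← blockDiagonal_one, ← blockDiagonal_neg]
  congr 1
  funext _
  ext i j
  fin_cases i <;> fin_cases j <;> simp

/-- The inverse of the matrix `Q`. -/
def Qinv (N m n : ℕ) : Matrix (Fin m ⊕ Ferm n) (Fin m ⊕ Ferm n) (Grassmann N) :=
  realBlocks N 1 ((2 : ℝ) • Omega n)

theorem Q_mul_Qinv : Q N m n * Qinv N m n = 1 := by
  rw [Q, Qinv, realBlocks_mul, smul_mul_smul_comm, Omega_mul_self, mul_one,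
    ← realBlocks_one]
  norm_num

theorem Qinv_mul_Q : Qinv N m n * Q N m n = 1 := by
  rw [Q, Qinv, realBlocks_mul, smul_mul_smul_comm, Omega_mul_self, mul_one,
    ← realBlocks_one]
  norm_num

theorem bodyMatrix_eq_zero_iff {Z : Matrix (Fin m ⊕ Ferm n) (Fin m ⊕ Ferm n) (Grassmann N)} :
    bodyMatrix N (Fin m) (Ferm n) Z = 0 ↔ ∀ i j, body N (Z i j) = 0 :=
  ⟨fun h i j => congrFun (congrFun h i) j, fun h => by ext i j; exact h i j⟩

/-- Elements of `O₀` with body the identity are exponentials of elements of `𝔰𝔬₀(Λ_N⁺)`. -/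
theorem exists_so0Nilpotent_exp_eq
    {M : Matrix (Fin m ⊕ Ferm n) (Fin m ⊕ Ferm n) (Grassmann N)}
    (hM : M ∈ superMat N (Fin m) (Ferm n)) (hQ : supertranspose M * Q N m n * M = Q N m n)
    (hb : bodyMatrix N (Fin m) (Ferm n) M = 1) :
    ∃ Z ∈ so0Nilpotent N m n, NormedSpace.exp Z.1 = M := by
  set u := M - 1 with hu
  have hub : bodyMatrix N (Fin m) (Ferm n) u = 0 := by rw [hu, map_sub, hb, map_one, sub_self]
  obtain ⟨p, hp⟩ := exists_aeval_nilpotent_exp_eq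
    (isNilpotent_of_body_eq_zero (bodyMatrix_eq_zero_iff.1 hub))
  rw [show 1 + u = M by rw [hu]; abel] at hp
  set Z := u * Polynomial.aeval u p with hZ
  have huM : u ∈ superMat N (Fin m) (Ferm n) := sub_mem hM (one_mem _)
  have hZM : Z ∈ superMat N (Fin m) (Ferm n) := mul_mem huM
    (Algebra.adjoin_le (Set.singleton_subset_iff.2 huM)
      (Polynomial.aeval_mem_adjoin_singleton ℝ u))
  have hZb : ∀ i j, body N (Z i j) = 0 := by
    rw [← bodyMatrix_eq_zero_iff, hZ, map_mul, hub, zero_mul]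
  have hZn : IsNilpotent Z := isNilpotent_of_body_eq_zero hZb
  obtain ⟨hSn, hS⟩ := supertranspose_nilpotent_exp hZM hZn
  -- Conjugation by `Q`, as a ring homomorphism, commutes with `exp`. Invariance of `Q` says that
  -- the supertranspose of `M` is `f` of its inverse, so `supertranspose Z` and `f (-Z)` have the
  -- same exponential.
  let f : Matrix (Fin m ⊕ Ferm n) (Fin m ⊕ Ferm n) (Grassmann N) →+*
      Matrix (Fin m ⊕ Ferm n) (Fin m ⊕ Ferm n) (Grassmann N) :=
    { toFun := fun x => Q N m n * x * Qinv N m n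
      map_one' := by rw [mul_one, Q_mul_Qinv]
      map_mul' := fun x y => by
        calc Q N m n * (x * y) * Qinv N m n
            = Q N m n * x * (1 * y) * Qinv N m n := by noncomm_ring
          _ = _ := by rw [← Qinv_mul_Q]; noncomm_ring
      map_zero' := by rw [mul_zero, zero_mul]
      map_add' := fun x y => by noncomm_ring }
  have hexp : IsNilpotent.exp (supertranspose Z) = IsNilpotent.exp (f (-Z)) := by
    rw [← IsNilpotent.map_exp hZn.neg, ← hS, hp]
    have h1 : M * IsNilpotent.exp (-Z) = 1 := by
      rw [← hp]; exact IsNilpotent.exp_mul_exp_neg_self hZn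
    change _ = Q N m n * IsNilpotent.exp (-Z) * Qinv N m n
    calc supertranspose M
        = supertranspose M * Q N m n * (M * IsNilpotent.exp (-Z)) * Qinv N m n := by
          rw [h1, mul_one, mul_assoc, Q_mul_Qinv, mul_one]
      _ = supertranspose M * Q N m n * M * IsNilpotent.exp (-Z) * Qinv N m n := by
          simp only [mul_assoc]
      _ = _ := by rw [hQ]
  have hST := eq_of_nilpotent_exp_eq hSn (hZn.neg.map f) hexp
  refine ⟨⟨Z, hZM⟩, ⟨?_, hZb⟩, ?_⟩
  · change supertranspose Z * Q N m n + Q N m n * Z = 0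
    rw [hST]
    change Q N m n * -Z * Qinv N m n * Q N m n + _ = 0
    rw [mul_assoc _ (Qinv N m n), Qinv_mul_Q, mul_one, mul_neg, neg_add_cancel]
  · exact (exp_eq_nilpotent_exp hZn).trans hp

theorem bodyMatrix_exp_so0Nilpotent {Z : superMat N (Fin m) (Ferm n)}
    (hZ : Z ∈ so0Nilpotent N m n) :
    bodyMatrix N (Fin m) (Ferm n) (NormedSpace.exp Z.1) = 1 := by
  have hn := isNilpotent_of_body_eq_zero hZ.2
  rw [exp_eq_nilpotent_exp hn, IsNilpotent.map_exp hn, bodyMatrix_eq_zero_iff.2 hZ.2,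
    IsNilpotent.exp_zero]

theorem exp_mul_exp_compact_symmetric {X Y : superMat N (Fin m) (Ferm n)}
    (hX : X ∈ compactPart N m n) (hY : Y ∈ symmetricPart N m n) :
    ∃ A D E, Dᵀ = -D ∧ Eᵀ = E ∧ Y.1 = realBlocks N 0 E ∧
      NormedSpace.exp X.1 * NormedSpace.exp Y.1 =
        realBlocks N (NormedSpace.exp A) (NormedSpace.exp D * NormedSpace.exp E) := by
  obtain ⟨A, -, D, ⟨-, hD⟩, hX⟩ := hX
  obtain ⟨E, ⟨-, hE⟩, hY⟩ := hY
  refine ⟨A, D, E, (LieAlgebra.Orthogonal.mem_so _ _ D).1 hD, hE, hY, ?_⟩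
  rw [hX, hY, exp_realBlocks, exp_realBlocks, realBlocks_mul, NormedSpace.exp_zero, mul_one]

/-- The orthogonal factor `exp D` drops out, so the product determines `E` whatever `D` is. -/
theorem transpose_exp_mul_self {ι : Type*} [Fintype ι] [DecidableEq ι] {D E : Matrix ι ι ℝ}
    (hD : Dᵀ = -D) (hE : Eᵀ = E) :
    (NormedSpace.exp D * NormedSpace.exp E)ᵀ * (NormedSpace.exp D * NormedSpace.exp E) =
      NormedSpace.exp (E + E) := by
  have h : NormedSpace.exp (-D) * NormedSpace.exp D = 1 := by
    rw [← Matrix.exp_add_of_commute _ _ (Commute.neg_left (Commute.refl D)), neg_add_cancel,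
      NormedSpace.exp_zero]
  rw [transpose_mul, ← Matrix.exp_transpose, ← Matrix.exp_transpose, hD, hE,
    Matrix.exp_add_of_commute _ _ (Commute.refl E), mul_assoc, ← mul_assoc (NormedSpace.exp (-D)),
    h, one_mul]

/-- The body of a superrotation and its polar decomposition. -/
theorem exists_body_decomposition {M : superMat N (Fin m) (Ferm n)} (hM : M ∈ SO0 N m n) :
    ∃ A D E, Aᵀ = -A ∧ Dᵀ = -D ∧ D ∈ spOmega n ∧ Eᵀ = E ∧ E ∈ spOmega n ∧
      (NormedSpace.exp A)ᵀ * NormedSpace.exp A = 1 ∧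
      (NormedSpace.exp D * NormedSpace.exp E)ᵀ * Omega n *
        (NormedSpace.exp D * NormedSpace.exp E) = Omega n ∧
      bodyMatrix N (Fin m) (Ferm n) M.1 =
        fromBlocks (NormedSpace.exp A) 0 0 (NormedSpace.exp D * NormedSpace.exp E) := by
  obtain ⟨hO, hdet⟩ := hM
  obtain ⟨A₀, D₀, hb, hbT⟩ := exists_bodyMatrix_eq M.2
  have hdet' := det_eq_det_of_sdet_eq_one hdet hb
  have h := congrArg (bodyMatrix N (Fin m) (Ferm n)) (sub_eq_zero.1 hO)
  rw [map_mul, map_mul, hb, hbT, Q, bodyMatrix_realBlocks, fromBlocks_multiply,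
    fromBlocks_multiply, fromBlocks_inj] at h
  obtain ⟨hA, -, -, hD⟩ := h
  have hA' : A₀ᵀ * A₀ = 1 := by simpa using hA
  have hD' : D₀ᵀ * Omega n * D₀ = Omega n := by
    have : (-(1 / 2) : ℝ) • (D₀ᵀ * Omega n * D₀) = (-(1 / 2) : ℝ) • Omega n := by
      simpa using hD
    exact smul_right_injective _ (by norm_num : (-(1 / 2) : ℝ) ≠ 0) this
  obtain ⟨D, E, hDT, hDs, hET, hEs, hDE⟩ :=
    exists_exp_mul_exp_of_symplectic (Omega_transpose n) (Omega_mul_self n) hD'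
  -- The only use of `sdet M = 1`: it excludes orthogonal bodies of determinant `-1`.
  have hpos : 0 < A₀.det := by
    rw [hdet', hDE, det_mul]
    exact mul_pos (det_exp_pos D) (det_exp_pos E)
  obtain ⟨A, hAT, rfl⟩ := exists_skew_exp_eq hA' hpos
  subst hDE
  exact ⟨A, D, E, hAT, hDT, hDs, hET, hEs, hA', hD', hb⟩

theorem exists_superrotation_decomposition {M : superMat N (Fin m) (Ferm n)}
    (hM : M ∈ SO0 N m n) :
    ∃ X ∈ compactPart N m n, ∃ Y ∈ symmetricPart N m n, ∃ Z ∈ so0Nilpotent N m n,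
      M.1 = NormedSpace.exp X.1 * NormedSpace.exp Y.1 * NormedSpace.exp Z.1 := by
  obtain ⟨A, D, E, hAT, hDT, hDs, hET, hEs, hA, hD, hb⟩ := exists_body_decomposition hM
  set A₀ := NormedSpace.exp A
  set D₀ := NormedSpace.exp D * NormedSpace.exp E with hD₀
  have hA' : A₀ * A₀ᵀ = 1 := mul_eq_one_comm.1 hA
  have hDu : IsUnit D₀ := (Matrix.isUnit_exp D).mul (Matrix.isUnit_exp E)
  have hDd : IsUnit D₀.det := (isUnit_iff_isUnit_det D₀).1 hDu
  have hDi : D₀⁻¹ᵀ * Omega n * D₀⁻¹ = Omega n := by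
    calc D₀⁻¹ᵀ * Omega n * D₀⁻¹ = D₀⁻¹ᵀ * (D₀ᵀ * Omega n * D₀) * D₀⁻¹ := by rw [hD]
      _ = (D₀ * D₀⁻¹)ᵀ * Omega n * (D₀ * D₀⁻¹) := by
        rw [transpose_mul D₀ D₀⁻¹]; simp only [mul_assoc]
      _ = Omega n := by rw [mul_nonsing_inv _ hDd, transpose_one, one_mul, mul_one]
  have hgg : realBlocks N A₀ D₀ * realBlocks N A₀ᵀ D₀⁻¹ = 1 := by
    rw [realBlocks_mul, hA', mul_nonsing_inv _ hDd, realBlocks_one]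
  have hgQ : supertranspose (realBlocks N A₀ᵀ D₀⁻¹) * Q N m n * realBlocks N A₀ᵀ D₀⁻¹ =
      Q N m n := by
    rw [Q, supertranspose_realBlocks, realBlocks_mul, realBlocks_mul, transpose_transpose, mul_one,
      hA', mul_smul_comm, smul_mul_assoc, hDi]
  obtain ⟨Z, hZ, hZe⟩ := exists_so0Nilpotent_exp_eq
    (M := realBlocks N A₀ᵀ D₀⁻¹ * M.1) (mul_mem (realBlocks_mem _ _) M.2)
    (by
      rw [supertranspose_mul (realBlocks_mem _ _) M.2]
      calc supertranspose M.1 * supertranspose (realBlocks N A₀ᵀ D₀⁻¹) * Q N m n *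
            (realBlocks N A₀ᵀ D₀⁻¹ * M.1)
          = supertranspose M.1 * (supertranspose (realBlocks N A₀ᵀ D₀⁻¹) * Q N m n *
            realBlocks N A₀ᵀ D₀⁻¹) * M.1 := by simp only [mul_assoc]
        _ = Q N m n := by rw [hgQ]; exact sub_eq_zero.1 hM.1)
    (by
      rw [map_mul, bodyMatrix_realBlocks, hb, fromBlocks_multiply, hA, nonsing_inv_mul _ hDd]
      simp)
  refine ⟨⟨realBlocks N A D, realBlocks_mem _ _⟩, ⟨A, (LieAlgebra.Orthogonal.mem_so _ _ A).2 hAT,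
    D, ⟨hDs, (LieAlgebra.Orthogonal.mem_so _ _ D).2 hDT⟩, rfl⟩,
    ⟨realBlocks N 0 E, realBlocks_mem _ _⟩, ⟨E, ⟨hEs, hET⟩, rfl⟩, Z, hZ, ?_⟩
  rw [exp_realBlocks, exp_realBlocks, realBlocks_mul, NormedSpace.exp_zero, mul_one, hZe, ← hD₀,
    ← mul_assoc, hgg, one_mul]

theorem superrotation_decomposition_unique
    {X Y Z X' Y' Z' : superMat N (Fin m) (Ferm n)}
    (hX : X ∈ compactPart N m n) (hY : Y ∈ symmetricPart N m n) (hZ : Z ∈ so0Nilpotent N m n)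
    (hX' : X' ∈ compactPart N m n) (hY' : Y' ∈ symmetricPart N m n)
    (hZ' : Z' ∈ so0Nilpotent N m n)
    (h : NormedSpace.exp X.1 * NormedSpace.exp Y.1 * NormedSpace.exp Z.1 =
      NormedSpace.exp X'.1 * NormedSpace.exp Y'.1 * NormedSpace.exp Z'.1) :
    Y = Y' ∧ Z = Z' := by
  obtain ⟨A, D, E, hDT, hET, hYE, hXY⟩ := exp_mul_exp_compact_symmetric hX hY
  obtain ⟨A', D', E', hDT', hET', hYE', hXY'⟩ := exp_mul_exp_compact_symmetric hX' hY'
  rw [hXY, hXY'] at h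
  have hb := congrArg (bodyMatrix N (Fin m) (Ferm n)) h
  rw [map_mul, map_mul, bodyMatrix_exp_so0Nilpotent hZ, bodyMatrix_exp_so0Nilpotent hZ', mul_one,
    mul_one, bodyMatrix_realBlocks, bodyMatrix_realBlocks, fromBlocks_inj] at hb
  obtain ⟨hA, -, -, hDE⟩ := hb
  have hEE : E + E = E' + E' := by
    refine eq_of_exp_eq_of_symm (by rw [transpose_add, hET]) (by rw [transpose_add, hET']) ?_
    rw [← transpose_exp_mul_self hDT hET, ← transpose_exp_mul_self hDT' hET', hDE]
  have hE : E = E' := by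
    rw [← two_smul ℝ E, ← two_smul ℝ E'] at hEE
    exact smul_right_injective _ (two_ne_zero' ℝ) hEE
  refine ⟨Subtype.ext (by rw [hYE, hYE', hE]), Subtype.ext ?_⟩
  have hu : IsUnit (realBlocks N (NormedSpace.exp A) (NormedSpace.exp D * NormedSpace.exp E)) := by
    have h1 := (isUnit_iff_isUnit_det _).1 (Matrix.isUnit_exp A)
    have h2 := (isUnit_iff_isUnit_det _).1 ((Matrix.isUnit_exp D).mul (Matrix.isUnit_exp E))
    refine isUnit_iff_exists.2 ⟨realBlocks N (NormedSpace.exp A)⁻¹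
      (NormedSpace.exp D * NormedSpace.exp E)⁻¹, ?_, ?_⟩
    · rw [realBlocks_mul, mul_nonsing_inv _ h1, mul_nonsing_inv _ h2, realBlocks_one]
    · rw [realBlocks_mul, nonsing_inv_mul _ h1, nonsing_inv_mul _ h2, realBlocks_one]
  -- `X` itself need not be unique, but the real factors `exp X * exp Y` agree and can be cancelled.
  rw [← hA, ← hDE] at h
  have hZn := isNilpotent_of_body_eq_zero hZ.2
  have hZn' := isNilpotent_of_body_eq_zero hZ'.2
  refine eq_of_nilpotent_exp_eq hZn hZn' ?_
  rw [← exp_eq_nilpotent_exp hZn, ← exp_eq_nilpotent_exp hZn']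
  exact hu.mul_left_cancel h

end Decomposition

end SuperRotation

end

theorem mainTheorem1 (N m n : ℕ)
    (M : SuperRotation.superMat N (Fin m) (SuperRotation.Ferm n))
    (hM : M ∈ SuperRotation.SO0 N m n) :
    (∃ X ∈ SuperRotation.compactPart N m n, ∃ Y ∈ SuperRotation.symmetricPart N m n,
      ∃ Z ∈ SuperRotation.so0Nilpotent N m n,
        M.1 = NormedSpace.exp X.1 * NormedSpace.exp Y.1 * NormedSpace.exp Z.1) ∧
    (∀ X ∈ SuperRotation.compactPart N m n, ∀ Y ∈ SuperRotation.symmetricPart N m n,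
      ∀ Z ∈ SuperRotation.so0Nilpotent N m n,
      ∀ X' ∈ SuperRotation.compactPart N m n, ∀ Y' ∈ SuperRotation.symmetricPart N m n,
      ∀ Z' ∈ SuperRotation.so0Nilpotent N m n,
        M.1 = NormedSpace.exp X.1 * NormedSpace.exp Y.1 * NormedSpace.exp Z.1 →
        M.1 = NormedSpace.exp X'.1 * NormedSpace.exp Y'.1 * NormedSpace.exp Z'.1 →
        Y = Y' ∧ Z = Z') :=
  ⟨SuperRotation.exists_superrotation_decomposition hM,
    fun _ hX _ hY _ hZ _ hX' _ hY' _ hZ' h h' =>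
      SuperRotation.superrotation_decomposition_unique hX hY hZ hX' hY' hZ' (h.symm.trans h')⟩
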